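/- **Theorem 4.1 (Bochner type formula).** Let $(M,g)$ be a smooth Riemannian manifold (without boundary) of finite dimension with Levi-Civita connection $\nabla$, and let $\alpha$ be a smooth real $1$-form on $M$. Extend $g$ to a Hermitian inner product $\langle\cdot,\cdot\rangle$ on $TM\otimes\mathbb C$, linear in the first and antilinear in the second argument, extend $\nabla$ and $d\alpha$ complex (bi)linearly and $\mathrm{Ric}$ sesquilinearly, and for a complex $1$-form $w$ let $w^\sharp$ be the vector field with $w(X)=\langle X,\overline{w^\sharp}\rangle$. Let $e_1,\dots,e_n$ denote a (real) orthonormal basis of a tangent space. For smooth $f:M\to\mathbb C$ and complex vector fields $X$, put - $d^\alpha f=df+if\alpha$ and $\nabla^\alpha f=(d^\alpha f)^\sharp$; - $\operatorname{div}X=\sum_i\langle\nabla_{e_i}X,e_i\rangle$, $\operatorname{div}^\alpha X=\operatorname{div}X+i\langle X,\alpha^\sharp\rangle$, $\Delta f=-\operatorname{div}((df)^\sharp)$, and $\Delta^\alpha f=(d^\alpha)^*d^\alpha f=-\operatorname{div}^\alpha(\nabla^\alpha f)$, where $(d^\alpha)^*\eta=-\operatorname{div}^\alpha(\eta^\sharp)$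 is the formal adjoint of $d^\alpha$; - $\nabla^\alpha_vX=\nabla_vX+i\alpha(v)X$, $\mathrm{Hess}^\alpha f(v,w)=\langle\nabla^\alpha_v\nabla^\alpha f,w\rangle$, and $|\mathrm{Hess}^\alpha f|^2=\sum_{i,j}|\mathrm{Hess}^\alpha f(e_i,e_j)|^2$; - $R(U,V)W=\nabla_U\nabla_VW-\nabla_V\nabla_UW-\nabla_{[U,V]}W$ and $\mathrm{Ric}(v,w)=\sum_i\langle R(e_i,v)w,e_i\rangle$; - $d\alpha(V,W)=V(\alpha(W))-W(\alpha(V))-\alpha([V,W])$, and for a $2$-form $\beta$, $\delta\beta(w)=-\sum_i(\nabla_{e_i}\beta)(e_i,w)$, the formal adjoint of the exterior derivative. Then for every smooth $f:M\to\mathbb C$, at every point of $M$, $$\begin{aligned}-\tfrac12\Delta\big(|\nabla^\alpha f|^2\big)={}&|\mathrm{Hess}^\alpha f|^2-\tfrac12\Big(\langle\nabla^\alpha f,\nabla^\alpha(\Delta^\alpha f)\rangle+\langle\nabla^\alpha(\Delta^\alpha f),\nabla^\alpha f\rangle\Big)+\mathrm{Ric}(\nabla^\alpha f,\nabla^\alpha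 f)\\&+i\Big(d\alpha(\nabla^\alpha f,\overline{\nabla^\alpha f})-d\alpha(\overline{\nabla^\alpha f},\nabla^\alpha f)\Big)+\frac i2\Big(\langle\bar f\,\nabla^\alpha f,(\delta d\alpha)^\sharp\rangle-\langle f\,\overline{\nabla^\alpha f},(\delta d\alpha)^\sharp\rangle\Big).\end{aligned}$$ -/

import Mathlib

set_option linter.unusedSectionVars false

open scoped Manifold ContDiff Bundle

noncomputable section
namespace MagneticBochner

section LeviCivita

variable {E : Type*} [NormedAddCommGroup E] [NormedSpace ℝ E] [FiniteDimensional ℝ E]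
  {H : Type*} [TopologicalSpace H] {I : ModelWithCorners ℝ E H}
  {M : Type*} [TopologicalSpace M] [ChartedSpace H M] [IsManifold I ∞ M]
  [Bundle.RiemannianBundle (fun x : M ↦ TangentSpace I x)]

/-- The right-hand side of Koszul's formula for `⟨∇_Y X, Z⟩` at `x`. -/
def koszul (X Y Z : Π x : M, TangentSpace I x) (x : M) : ℝ :=
  (1 / 2) *
    (mvfderiv I (fun y ↦ inner ℝ (X y) (Z y)) x (Y x)
      + mvfderiv I (fun y ↦ inner ℝ (Y y) (Z y)) x (X x)
      - mvfderiv I (fun y ↦ inner ℝ (X y) (Y y)) x (Z x)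
      + inner ℝ (VectorField.mlieBracket I Y X x) (Z x)
      - inner ℝ (VectorField.mlieBracket I Y Z x) (X x)
      - inner ℝ (VectorField.mlieBracket I X Z x) (Y x))

variable [IsContMDiffRiemannianBundle I ∞ E
    (fun x : M ↦ TangentSpace I x)]

instance finiteDimensional_tangentSpace (x : M) : FiniteDimensional ℝ (TangentSpace I x) :=
  inferInstanceAs (FiniteDimensional ℝ E)

instance completeSpace_tangentSpace (x : M) : CompleteSpace (TangentSpace I x) :=
  FiniteDimensional.complete ℝ _

theorem mdifferentiableAt_inner {X Y : Π x : M, TangentSpace I x} {x : M}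
    (hX : MDiffAt (T% X) x) (hY : MDiffAt (T% Y) x) :
    MDiffAt (fun y ↦ inner ℝ (X y) (Y y)) x :=
  MDifferentiableAt.inner_bundle (IB := I) (F := E) (E := fun x : M ↦ TangentSpace I x) hX hY

theorem koszul_tensorial_right {X Y : Π x : M, TangentSpace I x} {x : M}
    (hX : MDiffAt (T% X) x) (hY : MDiffAt (T% Y) x) :
    TensorialAt I E (fun Z ↦ koszul X Y Z x) x where
  smul {f Z} hf hZ := by
    have e1 : mvfderiv I (fun y ↦ f y * inner ℝ (X y) (Z y)) x = _ :=
      mvfderiv_fun_mul hf (mdifferentiableAt_inner hX hZ)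
    have e2 : mvfderiv I (fun y ↦ f y * inner ℝ (Y y) (Z y)) x = _ :=
      mvfderiv_fun_mul hf (mdifferentiableAt_inner hY hZ)
    simp [koszul, inner_add_left, inner_smul_left, inner_smul_right, e1, e2,
      VectorField.mlieBracket_smul_right hf hZ]
    rw [real_inner_comm (X x) (Z x), real_inner_comm (Y x) (Z x)]
    ring
  add {Z Z'} hZ hZ' := by
    have e1 : mvfderiv I (fun y ↦ inner ℝ (X y) (Z y) + inner ℝ (X y) (Z' y)) x = _ :=
      mvfderiv_fun_add (mdifferentiableAt_inner hX hZ) (mdifferentiableAt_inner hX hZ')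
    have e2 : mvfderiv I (fun y ↦ inner ℝ (Y y) (Z y) + inner ℝ (Y y) (Z' y)) x = _ :=
      mvfderiv_fun_add (mdifferentiableAt_inner hY hZ) (mdifferentiableAt_inner hY hZ')
    simp [koszul, inner_add_left, inner_add_right, e1, e2,
      VectorField.mlieBracket_add_right hZ hZ']
    ring

theorem koszul_tensorial_left {X Z : Π x : M, TangentSpace I x} {x : M}
    (hX : MDiffAt (T% X) x) (hZ : MDiffAt (T% Z) x) :
    TensorialAt I E (fun Y ↦ koszul X Y Z x) x where
  smul {f Y} hf hY := by
    have e1 : mvfderiv I (fun y ↦ f y * inner ℝ (Y y) (Z y)) x = _ :=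
      mvfderiv_fun_mul hf (mdifferentiableAt_inner hY hZ)
    have e2 : mvfderiv I (fun y ↦ f y * inner ℝ (X y) (Y y)) x = _ :=
      mvfderiv_fun_mul hf (mdifferentiableAt_inner hX hY)
    simp [koszul, inner_add_left, inner_smul_left, inner_smul_right, e1, e2,
      VectorField.mlieBracket_smul_left hf hY]
    rw [real_inner_comm (Y x) (X x)]
    ring
  add {Y Y'} hY hY' := by
    have e1 : mvfderiv I (fun y ↦ inner ℝ (Y y) (Z y) + inner ℝ (Y' y) (Z y)) x = _ :=
      mvfderiv_fun_add (mdifferentiableAt_inner hY hZ) (mdifferentiableAt_inner hY' hZ)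
    have e2 : mvfderiv I (fun y ↦ inner ℝ (X y) (Y y) + inner ℝ (X y) (Y' y)) x = _ :=
      mvfderiv_fun_add (mdifferentiableAt_inner hX hY) (mdifferentiableAt_inner hX hY')
    simp [koszul, inner_add_left, inner_add_right, e1, e2,
      VectorField.mlieBracket_add_left hY hY']
    ring

open Classical in
/-- `∇ X` at `x`, the linear map `v ↦ ∇_v X` given by Koszul's formula. -/
def leviCivitaAt (X : Π x : M, TangentSpace I x) (x : M) :
    TangentSpace I x →L[ℝ] TangentSpace I x :=
  if hX : MDiffAt (T% X) x then
    ((InnerProductSpace.toDual ℝ (TangentSpace I x)).symm.toContinuousLinearEquiv :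
        (TangentSpace I x →L[ℝ] ℝ) →L⋆[ℝ] TangentSpace I x) ∘L
      TensorialAt.mkHom₂ (fun Y Z ↦ koszul X Y Z x) x
        (fun _ hZ ↦ koszul_tensorial_left hX hZ) (fun _ hY ↦ koszul_tensorial_right hX hY)
  else 0

theorem inner_leviCivitaAt {X Y Z : Π x : M, TangentSpace I x} {x : M}
    (hX : MDiffAt (T% X) x) (hY : MDiffAt (T% Y) x) (hZ : MDiffAt (T% Z) x) :
    inner ℝ (leviCivitaAt X x (Y x)) (Z x) = koszul X Y Z x := by
  rw [leviCivitaAt, dif_pos hX]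
  exact (InnerProductSpace.toDual_symm_apply ..).trans (TensorialAt.mkHom₂_apply _ _ hY hZ)

theorem koszul_add {X X' Y Z : Π x : M, TangentSpace I x} {x : M} (hX : MDiffAt (T% X) x)
    (hX' : MDiffAt (T% X') x) (hY : MDiffAt (T% Y) x) (hZ : MDiffAt (T% Z) x) :
    koszul (X + X') Y Z x = koszul X Y Z x + koszul X' Y Z x := by
  have e1 : mvfderiv I (fun y ↦ inner ℝ (X y) (Z y) + inner ℝ (X' y) (Z y)) x = _ :=
    mvfderiv_fun_add (mdifferentiableAt_inner hX hZ) (mdifferentiableAt_inner hX' hZ)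
  have e2 : mvfderiv I (fun y ↦ inner ℝ (X y) (Y y) + inner ℝ (X' y) (Y y)) x = _ :=
    mvfderiv_fun_add (mdifferentiableAt_inner hX hY) (mdifferentiableAt_inner hX' hY)
  simp [koszul, inner_add_left, inner_add_right, e1, e2,
    VectorField.mlieBracket_add_left hX hX', VectorField.mlieBracket_add_right hX hX']
  ring

theorem koszul_smul {X Y Z : Π x : M, TangentSpace I x} {g : M → ℝ} {x : M}
    (hX : MDiffAt (T% X) x) (hg : MDiffAt g x) (hY : MDiffAt (T% Y) x) (hZ : MDiffAt (T% Z) x) :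
    koszul (g • X) Y Z x = g x * koszul X Y Z x + mvfderiv I g x (Y x) * inner ℝ (X x) (Z x) := by
  have e1 : mvfderiv I (fun y ↦ g y * inner ℝ (X y) (Z y)) x = _ :=
    mvfderiv_fun_mul hg (mdifferentiableAt_inner hX hZ)
  have e2 : mvfderiv I (fun y ↦ g y * inner ℝ (X y) (Y y)) x = _ :=
    mvfderiv_fun_mul hg (mdifferentiableAt_inner hX hY)
  simp [koszul, inner_add_left, inner_smul_left, inner_smul_right, e1, e2,
    VectorField.mlieBracket_smul_left hg hX, VectorField.mlieBracket_smul_right hg hX]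
  ring

theorem eq_of_inner_mdifferentiableAt {x : M} {A B : TangentSpace I x →L[ℝ] TangentSpace I x}
    (h : ∀ Y Z : Π x : M, TangentSpace I x, MDiffAt (T% Y) x → MDiffAt (T% Z) x →
      inner ℝ (A (Y x)) (Z x) = inner ℝ (B (Y x)) (Z x)) : A = B := by
  ext v
  refine ext_inner_right ℝ fun w ↦ ?_
  have h1 := h (FiberBundle.extend E v) (FiberBundle.extend E w)
    (FiberBundle.mdifferentiableAt_extend ..) (FiberBundle.mdifferentiableAt_extend ..)
  simpa using h1

/-- The Levi-Civita connection. -/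
def leviCivita : CovariantDerivative I E (fun x : M ↦ TangentSpace I x) where
  toFun := leviCivitaAt
  isCovariantDerivativeOnUniv :=
    { add := by
        intro X X' x hX hX' _
        refine eq_of_inner_mdifferentiableAt fun Y Z hY hZ ↦ ?_
        rw [add_apply, inner_add_left, inner_leviCivitaAt hX hY hZ,
          inner_leviCivitaAt hX' hY hZ,
          inner_leviCivitaAt (mdifferentiableAt_add_section hX hX') hY hZ, koszul_add hX hX' hY hZ]
      leibniz := by
        intro X g x hX hg _
        refine eq_of_inner_mdifferentiableAt fun Y Z hY hZ ↦ ?_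
        have h1 : MDiffAt (T% (g • X)) x := hg.smul_section hX
        rw [inner_leviCivitaAt h1 hY hZ, koszul_smul hX hg hY hZ]
        simp [inner_add_left, inner_smul_left, inner_leviCivitaAt hX hY hZ] }

theorem leviCivita_torsion :
    (leviCivita : CovariantDerivative I E (fun x : M ↦ TangentSpace I x)).torsion = 0 := by
  rw [CovariantDerivative.torsion_eq_zero_iff]
  intro X Y x hX hY
  refine ext_inner_right ℝ fun w ↦ ?_
  have hZ : MDiffAt (T% (FiberBundle.extend E w : Π x : M, TangentSpace I x)) x :=
    FiberBundle.mdifferentiableAt_extend ..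
  have h1 := inner_leviCivitaAt hY hX hZ
  have h2 := inner_leviCivitaAt hX hY hZ
  simp only [FiberBundle.extend_apply_self] at h1 h2
  change inner ℝ (leviCivitaAt Y x (X x) - leviCivitaAt X x (Y x)) w = _
  rw [inner_sub_left, h1, h2]
  simp only [koszul, FiberBundle.extend_apply_self, real_inner_comm]
  rw [VectorField.mlieBracket_swap_apply (V := Y) (W := X), inner_neg_right]
  ring

theorem leviCivita_metric {X Y Z : Π x : M, TangentSpace I x} {x : M}
    (hX : MDiffAt (T% X) x) (hY : MDiffAt (T% Y) x) (hZ : MDiffAt (T% Z) x) :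
    mvfderiv I (fun y ↦ inner ℝ (Y y) (Z y)) x (X x) =
      inner ℝ (leviCivita Y x (X x)) (Z x) + inner ℝ (Y x) (leviCivita Z x (X x)) := by
  have h1 := inner_leviCivitaAt hY hX hZ
  have h2 := inner_leviCivitaAt hZ hX hY
  rw [real_inner_comm] at h2
  change _ = inner ℝ (leviCivitaAt Y x (X x)) (Z x) + inner ℝ (Y x) (leviCivitaAt Z x (X x))
  rw [h1, h2]
  simp only [koszul]
  rw [VectorField.mlieBracket_swap_apply (V := Z) (W := Y), inner_neg_left]
  simp only [real_inner_comm]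
  ring

end LeviCivita

/-! ### Complexified vector spaces -/

/-- The complexification `V ⊗ ℂ = V ⊕ iV` of a real vector space: `⟨a, b⟩` stands for `a + ib`. -/
@[ext] structure Complexification (V : Type*) where
  /-- The real part. -/
  re : V
  /-- The imaginary part. -/
  im : V

namespace Complexification

variable {V : Type*}

instance [Add V] : Add (Complexification V) := ⟨fun X Y ↦ ⟨X.re + Y.re, X.im + Y.im⟩⟩

instance [AddCommGroup V] [Module ℝ V] : SMul ℂ (Complexification V) :=
  ⟨fun c X ↦ ⟨c.re • X.re - c.im • X.im, c.re • X.im + c.im • X.re⟩⟩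

/-- Complex conjugation. -/
def conj [Neg V] (X : Complexification V) : Complexification V := ⟨X.re, -X.im⟩

/-- The extension of a real bilinear form that is linear in both arguments. -/
def bilin (B : V → V → ℝ) (X Y : Complexification V) : ℂ :=
  ⟨B X.re Y.re - B X.im Y.im, B X.re Y.im + B X.im Y.re⟩

/-- The extension of a real bilinear form that is linear in the first and antilinear in the second
argument. -/
def sesq (B : V → V → ℝ) (X Y : Complexification V) : ℂ :=
  ⟨B X.re Y.re + B X.im Y.im, B X.im Y.re - B X.re Y.im⟩

/-- The Hermitian extension `⟨X, Y⟩` of a real inner product, linear in `X`. -/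
def hinner [NormedAddCommGroup V] [InnerProductSpace ℝ V] (X Y : Complexification V) : ℂ :=
  sesq (fun v w ↦ inner ℝ v w) X Y

/-- The squared norm `|X|² = ⟨X, X⟩`, a real number. -/
def normSq [NormedAddCommGroup V] [InnerProductSpace ℝ V] (X : Complexification V) : ℝ :=
  ‖X.re‖ ^ 2 + ‖X.im‖ ^ 2

/-- A real vector as an element of the complexification. -/
def ofReal [Zero V] (v : V) : Complexification V := ⟨v, 0⟩

end Complexification

open Complexification

/-! ### Real tensors on a Riemannian manifold -/

section Riemannian

variable {E : Type*} [NormedAddCommGroup E] [NormedSpace ℝ E] [FiniteDimensional ℝ E]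
  {H : Type*} [TopologicalSpace H] {I : ModelWithCorners ℝ E H}
  {M : Type*} [TopologicalSpace M] [ChartedSpace H M] [IsManifold I ∞ M]

/-- The exterior derivative of a `1`-form,
`dα(V, W) = V(α(W)) - W(α(V)) - α([V, W])`,
evaluated at tangent vectors `v`, `w` through local extensions of them to smooth fields. -/
def extDeriv (α : Π x : M, TangentSpace I x →L[ℝ] ℝ) (x : M) (v w : TangentSpace I x) : ℝ :=
  mvfderiv I (fun y ↦ α y (FiberBundle.extend E w y)) x v
    - mvfderiv I (fun y ↦ α y (FiberBundle.extend E v y)) x w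
    - α x (VectorField.mlieBracket I (FiberBundle.extend E v) (FiberBundle.extend E w) x)

variable [Bundle.RiemannianBundle (fun x : M ↦ TangentSpace I x)]

/-- The musical isomorphism: the vector `w^♯ = ∑ w(eᵢ) eᵢ` of a complex valued covector `w` (a
real-linear function `T_xM → ℂ`), where `eᵢ` is an orthonormal basis of `T_xM`; it is the vector
with `w(X) = ⟨X, conj w^♯⟩`. -/
def sharp {x : M} (w : TangentSpace I x → ℂ) : Complexification (TangentSpace I x) :=
  ⟨∑ i, (w (stdOrthonormalBasis ℝ (TangentSpace I x) i)).re •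
      stdOrthonormalBasis ℝ (TangentSpace I x) i,
    ∑ i, (w (stdOrthonormalBasis ℝ (TangentSpace I x) i)).im •
      stdOrthonormalBasis ℝ (TangentSpace I x) i⟩

variable [IsContMDiffRiemannianBundle I ∞ E (fun x : M ↦ TangentSpace I x)]

/-- The curvature tensor `R(U, V)W = ∇_U ∇_V W - ∇_V ∇_U W - ∇_{[U, V]} W`, evaluated at tangent
vectors through local extensions of them to smooth fields. -/
def curvature (x : M) (u v w : TangentSpace I x) : TangentSpace I x :=
  let U : Π y : M, TangentSpace I y := FiberBundle.extend E u
  let V : Π y : M, TangentSpace I y := FiberBundle.extend E v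
  let W : Π y : M, TangentSpace I y := FiberBundle.extend E w
  leviCivita (fun y ↦ leviCivita W y (V y)) x u - leviCivita (fun y ↦ leviCivita W y (U y)) x v
    - leviCivita W x (VectorField.mlieBracket I U V x)

/-- The Ricci tensor `Ric(v, w) = ∑ ⟨R(eᵢ, v)w, eᵢ⟩`. -/
def ricci (x : M) (v w : TangentSpace I x) : ℝ :=
  ∑ i, inner ℝ (curvature x (stdOrthonormalBasis ℝ (TangentSpace I x) i) v w)
    (stdOrthonormalBasis ℝ (TangentSpace I x) i)

/-- The covariant derivative of a `2`-form,
`(∇_v β)(u, w) = v(β(U, W)) - β(∇_v U, w) - β(u, ∇_v W)`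
for local smooth extensions `U`, `W` of `u`, `w`. -/
def covDerivTwoForm (β : Π x : M, TangentSpace I x → TangentSpace I x → ℝ) (x : M)
    (v u w : TangentSpace I x) : ℝ :=
  mvfderiv I (fun y ↦ β y (FiberBundle.extend E u y) (FiberBundle.extend E w y)) x v
    - β x (leviCivita (FiberBundle.extend E u) x v) w
    - β x u (leviCivita (FiberBundle.extend E w) x v)

/-- The codifferential of a `2`-form, `(δβ)(w) = -∑ (∇_{eᵢ} β)(eᵢ, w)`: the formal adjoint of the
exterior derivative of `1`-forms. -/
def codifferential (β : Π x : M, TangentSpace I x → TangentSpace I x → ℝ) (x : M)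
    (w : TangentSpace I x) : ℝ :=
  -∑ i, covDerivTwoForm β x (stdOrthonormalBasis ℝ (TangentSpace I x) i)
    (stdOrthonormalBasis ℝ (TangentSpace I x) i) w

/-! ### Complex vector fields and functions -/

/-- The Levi-Civita connection on complex vector fields, `∇_v (A + iB) = ∇_v A + i ∇_v B`. -/
def covDeriv (X : Π x : M, Complexification (TangentSpace I x)) (x : M) (v : TangentSpace I x) :
    Complexification (TangentSpace I x) :=
  ⟨leviCivita (fun y ↦ (X y).re) x v, leviCivita (fun y ↦ (X y).im) x v⟩

/-- The divergence of a complex vector field, the trace of `∇ X`. -/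
def divergence (X : Π x : M, Complexification (TangentSpace I x)) (x : M) : ℂ :=
  ∑ i, hinner (covDeriv X x (stdOrthonormalBasis ℝ (TangentSpace I x) i))
    (ofReal (stdOrthonormalBasis ℝ (TangentSpace I x) i))

variable (I) in
/-- The gradient of a complex valued function. -/
def gradient (f : M → ℂ) (x : M) : Complexification (TangentSpace I x) :=
  sharp (mvfderiv I f x)

variable (I) in
/-- The Laplace-Beltrami operator `Δ = -div grad`. -/
def laplaceBeltrami (f : M → ℂ) (x : M) : ℂ :=
  -divergence (gradient I f) x

/-! ### Magnetic operators -/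

variable (α : Π x : M, TangentSpace I x →L[ℝ] ℝ)

/-- The magnetic differential `d^α f = df + i f α`. -/
def magneticDifferential (f : M → ℂ) (x : M) (v : TangentSpace I x) : ℂ :=
  mvfderiv I f x v + Complex.I * f x * α x v

/-- The magnetic gradient `∇^α f = (d^α f)^♯`. -/
def magneticGradient (f : M → ℂ) (x : M) : Complexification (TangentSpace I x) :=
  sharp (magneticDifferential α f x)

/-- The vector field `α^♯`. -/
def potentialField (x : M) : Complexification (TangentSpace I x) :=
  sharp (fun v ↦ (α x v : ℂ))

/-- The magnetic divergence `div^α X = div X + i ⟨X, α^♯⟩`. -/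
def magneticDivergence (X : Π x : M, Complexification (TangentSpace I x)) (x : M) : ℂ :=
  divergence X x + Complex.I * hinner (X x) (potentialField α x)

/-- The formal adjoint `(d^α)^* η = -div^α η^♯` of `d^α`. -/
def magneticCodifferential (η : Π x : M, TangentSpace I x → ℂ) (x : M) : ℂ :=
  -magneticDivergence α (fun y ↦ sharp (η y)) x

/-- The magnetic Laplacian `Δ^α f = (d^α)^* d^α f = -div^α ∇^α f`. -/
def magneticLaplacian (f : M → ℂ) (x : M) : ℂ :=
  magneticCodifferential α (magneticDifferential α f) x

/-- The magnetic covariant derivative `∇^α_v X = ∇_v X + i α(v) X`. -/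
def magneticCovDeriv (X : Π x : M, Complexification (TangentSpace I x)) (x : M)
    (v : TangentSpace I x) : Complexification (TangentSpace I x) :=
  covDeriv X x v + (Complex.I * α x v) • X x

/-- The magnetic Hessian `Hess^α f(v, w) = ⟨∇^α_v ∇^α f, w⟩` at real tangent vectors. -/
def magneticHessian (f : M → ℂ) (x : M) (v w : TangentSpace I x) : ℂ :=
  hinner (magneticCovDeriv α (magneticGradient α f) x v) (ofReal w)

/-- The squared Hilbert-Schmidt norm `|Hess^α f|² = ∑ |Hess^α f(eᵢ, eⱼ)|²`. -/
def magneticHessianNormSq (f : M → ℂ) (x : M) : ℝ :=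
  ∑ i, ∑ j, ‖magneticHessian α f x (stdOrthonormalBasis ℝ (TangentSpace I x) i)
    (stdOrthonormalBasis ℝ (TangentSpace I x) j)‖ ^ 2

end Riemannian

end MagneticBochner

end

/-! Write `f = u + ih`, `∇^α f = A + iB` and `N = α^♯`, so that `A = ∇u - hN` and `B = ∇h + uN`. The
formula becomes an identity between real vector fields, `magnetic_bochner_real`.

For any real field `A`, the Weitzenböck formula `sum_inner_secondCovDeriv` gives `div ∇(|A|²/2) =
|∇A|² + A(div A) + Ric(A, A) - δ(dA♭)(A)`. Its ingredients are the Ricci identity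
`secondCovDeriv_swap` and the fact that the trace commutes with covariant differentiation,
`mvfderiv_realDivergence`. For an ordinary gradient the last term is absent. Here `A` and `B` are
not closed, but their exterior derivatives are explicit: since `dh = B♭ - uα`, `du = A♭ + hα` and `α
∧ α = 0`, one gets `dA♭ = -h dα - B♭ ∧ α` and `dB♭ = u dα + A♭ ∧ α`.

Applying `δ` to these forms yields the `δdα` terms, multiples of `dα(A, B)`, and first-order terms
in `A` and `B`. The last are what is needed to complete `|∇A|² + |∇B|²` to `|∇A - α ⊗ B|² + |∇B + α
⊗ A|² = |Hess^α f|²` and to replace the divergences by the magnetic Laplacian. In total `dα(A, B)`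
gets the factor 4, which is also what the complex expression in `dα` amounts to.

The definitions evaluate tensors through local extensions that are smooth only near a point. All
calculus is therefore done with fields and functions smooth near the point, a class closed under
brackets and under the Levi-Civita connection. -/

noncomputable section
namespace MagneticBochner
open Complexification Filter Topology

/-! ### Functions and vector fields smooth near a point; orthonormal frames. -/

section LocalSmoothness

variable {E : Type*} [NormedAddCommGroup E] [NormedSpace ℝ E] [FiniteDimensional ℝ E]
  {H : Type*} [TopologicalSpace H] {I : ModelWithCorners ℝ E H}
  {M : Type*} [TopologicalSpace M] [ChartedSpace H M] [IsManifold I ∞ M]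

variable (I) in
/-- A real function that is smooth on a neighbourhood of `x`. -/
def SmoothFunNear (f : M → ℝ) (x : M) : Prop :=
  ∀ᶠ y in 𝓝 x, ContMDiffAt I 𝓘(ℝ, ℝ) ∞ f y

/-- A vector field that is smooth on a neighbourhood of `x`. -/
def SmoothNear (X : Π x : M, TangentSpace I x) (x : M) : Prop :=
  ∀ᶠ y in 𝓝 x, ContMDiffAt I (I.prod 𝓘(ℝ, E)) ∞ (fun z ↦ Bundle.TotalSpace.mk' E z (X z)) y

theorem SmoothFunNear.eventually {f : M → ℝ} {x : M} (h : SmoothFunNear I f x) :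
    ∀ᶠ y in 𝓝 x, SmoothFunNear I f y :=
  eventually_eventually_nhds.2 h

theorem SmoothNear.eventually {X : Π x : M, TangentSpace I x} {x : M} (h : SmoothNear X x) :
    ∀ᶠ y in 𝓝 x, SmoothNear X y :=
  eventually_eventually_nhds.2 h

theorem SmoothFunNear.mdiff {f : M → ℝ} {x : M} (h : SmoothFunNear I f x) : MDiffAt f x :=
  h.self_of_nhds.mdifferentiableAt (by simp)

theorem SmoothNear.mdiff {X : Π x : M, TangentSpace I x} {x : M} (h : SmoothNear X x) :
    MDiffAt (T% X) x :=
  h.self_of_nhds.mdifferentiableAt (by simp)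

theorem SmoothFunNear.congr {f g : M → ℝ} {x : M} (h : SmoothFunNear I f x)
    (hfg : ∀ᶠ y in 𝓝 x, g y = f y) : SmoothFunNear I g x := by
  filter_upwards [h, eventually_eventually_nhds.2 hfg] with y hy h1
  exact hy.congr_of_eventuallyEq h1

theorem SmoothNear.congr {X Y : Π x : M, TangentSpace I x} {x : M} (h : SmoothNear X x)
    (hXY : ∀ᶠ y in 𝓝 x, Y y = X y) : SmoothNear Y x := by
  filter_upwards [h, eventually_eventually_nhds.2 hXY] with y hy h1
  refine hy.congr_of_eventuallyEq ?_
  filter_upwards [h1] with z hz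
  rw [hz]

theorem SmoothFunNear.add {f g : M → ℝ} {x : M} (hf : SmoothFunNear I f x)
    (hg : SmoothFunNear I g x) : SmoothFunNear I (fun y ↦ f y + g y) x := by
  filter_upwards [hf, hg] with y h1 h2 using h1.add h2

theorem SmoothFunNear.sub {f g : M → ℝ} {x : M} (hf : SmoothFunNear I f x)
    (hg : SmoothFunNear I g x) : SmoothFunNear I (fun y ↦ f y - g y) x := by
  filter_upwards [hf, hg] with y h1 h2 using h1.sub h2

theorem SmoothFunNear.mul {f g : M → ℝ} {x : M} (hf : SmoothFunNear I f x)
    (hg : SmoothFunNear I g x) : SmoothFunNear I (fun y ↦ f y * g y) x := by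
  filter_upwards [hf, hg] with y h1 h2 using h1.mul h2

theorem SmoothFunNear.const (c : ℝ) (x : M) : SmoothFunNear I (fun _ ↦ c) x :=
  Eventually.of_forall fun _ ↦ contMDiffAt_const

theorem SmoothFunNear.sum {ι : Type*} {s : Finset ι} {f : ι → M → ℝ} {x : M}
    (hf : ∀ i ∈ s, SmoothFunNear I (f i) x) : SmoothFunNear I (fun y ↦ ∑ i ∈ s, f i y) x := by
  classical
  induction s using Finset.induction_on with
  | empty => simpa using SmoothFunNear.const 0 x
  | insert a s ha ih =>
    simp only [Finset.sum_insert ha]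
    exact (hf a (by simp)).add (ih fun i hi ↦ hf i (by simp [hi]))

theorem SmoothNear.add {X Y : Π x : M, TangentSpace I x} {x : M} (hX : SmoothNear X x)
    (hY : SmoothNear Y x) : SmoothNear (fun y ↦ X y + Y y) x := by
  filter_upwards [hX, hY] with y h1 h2 using h1.add_section h2

theorem SmoothNear.sub {X Y : Π x : M, TangentSpace I x} {x : M} (hX : SmoothNear X x)
    (hY : SmoothNear Y x) : SmoothNear (fun y ↦ X y - Y y) x := by
  filter_upwards [hX, hY] with y h1 h2 using h1.sub_section h2

theorem SmoothNear.smul {f : M → ℝ} {X : Π x : M, TangentSpace I x} {x : M}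
    (hf : SmoothFunNear I f x) (hX : SmoothNear X x) : SmoothNear (fun y ↦ f y • X y) x := by
  filter_upwards [hf, hX] with y h1 h2 using h1.smul_section h2

theorem SmoothNear.zero (x : M) : SmoothNear (fun y ↦ (0 : TangentSpace I y)) x :=
  Eventually.of_forall fun y ↦ Bundle.contMDiff_zeroSection ℝ (fun z : M ↦ TangentSpace I z) y

theorem SmoothNear.sum {ι : Type*} {s : Finset ι} {X : ι → Π x : M, TangentSpace I x} {x : M}
    (hX : ∀ i ∈ s, SmoothNear (X i) x) : SmoothNear (fun y ↦ ∑ i ∈ s, X i y) x := by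
  classical
  induction s using Finset.induction_on with
  | empty => simpa using SmoothNear.zero x
  | insert a s ha ih =>
    simp only [Finset.sum_insert ha]
    exact (hX a (by simp)).add (ih fun i hi ↦ hX i (by simp [hi]))

protected theorem SmoothNear.extend {x : M} (v : TangentSpace I x) :
    SmoothNear (FiberBundle.extend E v : Π y : M, TangentSpace I y) x := by
  obtain ⟨s, hs, h⟩ := FiberBundle.exists_contMDiffOn_extend (k := ∞) I E v
  filter_upwards [eventually_mem_nhds_iff.2 hs] with y hy
  exact h.contMDiffAt hy

protected theorem SmoothNear.mlieBracket {X Y : Π x : M, TangentSpace I x} {x : M} (hX : SmoothNear X x)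
    (hY : SmoothNear Y x) : SmoothNear (fun y ↦ VectorField.mlieBracket I X Y y) x := by
  filter_upwards [hX, hY] with y h1 h2
  have : IsManifold I (((⊤ : ℕ∞) : WithTop ℕ∞) + 1) M := inferInstanceAs (IsManifold I ∞ M)
  have : IsManifold I (minSmoothness ℝ 2) M := by
    rw [minSmoothness_of_isRCLikeNormedField]
    exact IsManifold.of_le (m := 2) (n := ∞) ENat.LEInfty.out
  exact ContMDiffAt.mlieBracket_vectorField (n := ⊤) (m := ⊤) h1 h2 (by simp)

/-- The derivative of a smooth function along a smooth field is smooth. -/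
protected theorem SmoothFunNear.mvfderiv {f : M → ℝ} {X : Π x : M, TangentSpace I x} {x : M}
    (hf : SmoothFunNear I f x) (hX : SmoothNear X x) :
    SmoothFunNear I (fun y ↦ mvfderiv I f y (X y)) x := by
  filter_upwards [hf, hX] with y h1 h2
  have h3 := h1.mfderiv_const (m := ∞) (by simp)
  have h4 : ContMDiffAt I (𝓘(ℝ, ℝ).prod 𝓘(ℝ, ℝ)) ∞
      (fun z ↦ Bundle.TotalSpace.mk' ℝ (E := TangentSpace 𝓘(ℝ, ℝ)) (f z)
        (mfderiv I 𝓘(ℝ, ℝ) f z (X z))) y :=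
    ContMDiffAt.clm_apply_of_inCoordinates (b₁ := id) (b₂ := f) h3 h2 h1
  -- The tangent bundle of `ℝ` is trivial, so the fibre component of this smooth map is the
  -- derivative itself.
  rw [Bundle.contMDiffAt_totalSpace] at h4
  simpa using! h4.2

variable [Bundle.RiemannianBundle (fun x : M ↦ TangentSpace I x)]
  [IsContMDiffRiemannianBundle I ∞ E (fun x : M ↦ TangentSpace I x)]

protected theorem SmoothNear.inner {X Y : Π x : M, TangentSpace I x} {x : M} (hX : SmoothNear X x)
    (hY : SmoothNear Y x) : SmoothFunNear I (fun y ↦ inner ℝ (X y) (Y y)) x := by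
  filter_upwards [hX, hY] with y h1 h2
  exact ContMDiffAt.inner_bundle (IB := I) (F := E) (E := fun x : M ↦ TangentSpace I x) h1 h2

theorem SmoothFunNear.div {f g : M → ℝ} {x : M} (hf : SmoothFunNear I f x)
    (hg : SmoothFunNear I g x) (h : ∀ᶠ y in 𝓝 x, g y ≠ 0) :
    SmoothFunNear I (fun y ↦ f y / g y) x := by
  filter_upwards [hf, hg, h] with y h1 h2 h3
  exact h1.div₀ h2 h3

theorem SmoothFunNear.inv_norm {X : Π x : M, TangentSpace I x} {x : M} (hX : SmoothNear X x)
    (h : ∀ᶠ y in 𝓝 x, X y ≠ 0) : SmoothFunNear I (fun y ↦ ‖X y‖⁻¹) x := by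
  have h0 := hX.inner hX
  filter_upwards [h0, h] with y h1 h2
  have h3 : ContDiffAt ℝ ∞ (fun t : ℝ ↦ (√t)⁻¹) (inner ℝ (X y) (X y)) := by
    have : (inner ℝ (X y) (X y) : ℝ) ≠ 0 := inner_self_ne_zero.2 h2
    refine (Real.contDiffAt_sqrt this).inv ?_
    rw [Real.sqrt_ne_zero']
    exact lt_of_le_of_ne (real_inner_self_nonneg) this.symm
  have h4 := h3.contMDiffAt.comp y h1
  refine h4.congr_of_eventuallyEq (Eventually.of_forall fun z ↦ ?_)
  simp

variable (I) in
/-- Smooth orthonormal frames exist near every point. -/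
theorem exists_orthonormal_frame (x : M) :
    ∃ e : Fin (Module.finrank ℝ E) → Π y : M, TangentSpace I y, (∀ i, SmoothNear (e i) x) ∧
      ∀ᶠ y in 𝓝 x, ∃ b : OrthonormalBasis (Fin (Module.finrank ℝ E)) ℝ (TangentSpace I y),
        ∀ i, b i = e i y := by
  let t := trivializationAt E (fun y : M ↦ TangentSpace I y) x
  let b₀ := Module.finBasis ℝ E
  have hx : x ∈ t.baseSet := FiberBundle.mem_baseSet_trivializationAt' x
  have hs : ∀ᶠ y in 𝓝 x, y ∈ t.baseSet := t.open_baseSet.mem_nhds hx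
  let s : Fin (Module.finrank ℝ E) → Π y : M, TangentSpace I y := t.localFrame b₀
  have hframe : IsLocalFrameOn I E ∞ s t.baseSet := t.isLocalFrameOn_localFrame_baseSet I ∞ b₀
  have hsm : ∀ i, SmoothNear (s i) x := fun i ↦ by
    filter_upwards [hs] with y hy
    exact hframe.contMDiffAt t.open_baseSet hy i
  have hli : ∀ᶠ y in 𝓝 x, LinearIndependent ℝ (fun i ↦ s i y) := by
    filter_upwards [hs] with y hy using hframe.linearIndependent hy
  let g : Fin (Module.finrank ℝ E) → Π y : M, TangentSpace I y :=
    fun i y ↦ InnerProductSpace.gramSchmidt ℝ (fun j ↦ s j y) i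
  have hg0 : ∀ i, ∀ᶠ y in 𝓝 x, g i y ≠ 0 := fun i ↦ by
    filter_upwards [hli] with y hy using InnerProductSpace.gramSchmidt_ne_zero i hy
  -- Gram-Schmidt is applied pointwise to a local frame. Each vector is smooth by strong induction,
  -- because the denominators are squared norms of earlier vectors, nonzero near `x`.
  have hg : ∀ i, SmoothNear (g i) x := by
    intro i
    induction i using WellFoundedLT.induction with
    | ind i ih =>
      have h1 : SmoothNear (fun y ↦ s i y - ∑ j ∈ Finset.Iio i,
          ((inner ℝ (g j y) (s i y) / inner ℝ (g j y) (g j y) : ℝ)) • g j y) x := by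
        refine (hsm i).sub (SmoothNear.sum fun j hj ↦ ?_)
        have hj' := ih j (by simpa using hj)
        refine SmoothNear.smul ((hj'.inner (hsm i)).div (hj'.inner hj') ?_) hj'
        filter_upwards [hg0 j] with y hy using inner_self_ne_zero.2 hy
      refine h1.congr (Eventually.of_forall fun y ↦ ?_)
      simp only [g]
      rw [InnerProductSpace.gramSchmidt_def]
      simp [Submodule.starProjection_singleton]
  refine ⟨fun i y ↦ ‖g i y‖⁻¹ • g i y,
    fun i ↦ SmoothNear.smul (SmoothFunNear.inv_norm (hg i) (hg0 i)) (hg i), ?_⟩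
  filter_upwards [hli] with y hy
  have ho := InnerProductSpace.gramSchmidtNormed_orthonormal (𝕜 := ℝ) hy
  have hc : Module.finrank ℝ (TangentSpace I y) = Fintype.card (Fin (Module.finrank ℝ E)) := by
    rw [Fintype.card_fin]; rfl
  refine ⟨InnerProductSpace.gramSchmidtOrthonormalBasis hc (fun j ↦ s j y), fun i ↦ ?_⟩
  rw [InnerProductSpace.gramSchmidtOrthonormalBasis_apply _ (ho.ne_zero i)]
  simp [InnerProductSpace.gramSchmidtNormed, g]

/-- A field whose inner products with all smooth fields are smooth is smooth. -/
theorem SmoothNear.of_inner {X : Π x : M, TangentSpace I x} {x : M}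
    (h : ∀ Z : Π x : M, TangentSpace I x, SmoothNear Z x →
      SmoothFunNear I (fun y ↦ inner ℝ (X y) (Z y)) x) : SmoothNear X x := by
  obtain ⟨e, he, hb⟩ := exists_orthonormal_frame I x
  have h1 : SmoothNear (fun y ↦ ∑ i, (inner ℝ (X y) (e i y) : ℝ) • e i y) x :=
    SmoothNear.sum fun i _ ↦ SmoothNear.smul (h _ (he i)) (he i)
  refine h1.congr ?_
  filter_upwards [hb] with y ⟨b, hy⟩
  simp only [← hy, real_inner_comm (b _)]
  exact (b.sum_repr' (X y)).symm

/-- The Levi-Civita connection preserves smoothness. -/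
protected theorem SmoothNear.leviCivita {X Y : Π x : M, TangentSpace I x} {x : M} (hX : SmoothNear X x)
    (hY : SmoothNear Y x) : SmoothNear (fun y ↦ leviCivita X y (Y y)) x := by
  refine SmoothNear.of_inner fun Z hZ ↦ ?_
  have h1 : SmoothFunNear I (koszul X Y Z) x := by
    unfold koszul
    exact (SmoothFunNear.const _ x).mul
      (((((((hX.inner hZ).mvfderiv hY).add ((hY.inner hZ).mvfderiv hX)).sub
        ((hX.inner hY).mvfderiv hZ)).add ((hY.mlieBracket hX).inner hZ)).sub
        ((hY.mlieBracket hZ).inner hX)).sub ((hX.mlieBracket hZ).inner hY))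
  refine h1.congr ?_
  filter_upwards [hX.eventually, hY.eventually, hZ.eventually] with y h1 h2 h3
  exact inner_leviCivitaAt h1.mdiff h2.mdiff h3.mdiff

end LocalSmoothness

/-! ### Commutators, symmetries of the curvature and of the Ricci tensor. -/

section Curvature

variable {E : Type*} [NormedAddCommGroup E] [NormedSpace ℝ E] [FiniteDimensional ℝ E]
  {H : Type*} [TopologicalSpace H] {I : ModelWithCorners ℝ E H}
  {M : Type*} [TopologicalSpace M] [ChartedSpace H M] [IsManifold I ∞ M]

theorem mvfderiv_congr {F : Type*} [NormedAddCommGroup F] [NormedSpace ℝ F] {f g : M → F} {x : M}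
    (h : ∀ᶠ y in 𝓝 x, f y = g y) : mvfderiv I f x = mvfderiv I g x := by
  have h' : f =ᶠ[𝓝 x] g := h
  unfold mvfderiv
  ext v
  simp only [ContinuousLinearMap.comp_apply]
  rw [h'.mfderiv_eq]
  rfl

theorem mlieBracket_congr {X Y X' Y' : Π x : M, TangentSpace I x} {x : M}
    (hX : ∀ᶠ y in 𝓝 x, X y = X' y) (hY : ∀ᶠ y in 𝓝 x, Y y = Y' y) :
    VectorField.mlieBracket I X Y x = VectorField.mlieBracket I X' Y' x :=
  Filter.EventuallyEq.mlieBracket_vectorField_eq hX hY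

/-- The Lie bracket acts on functions as the commutator of derivations. -/
theorem mvfderiv_mlieBracket {f : M → ℝ} {U V : Π x : M, TangentSpace I x} {x : M}
    (hf : SmoothFunNear I f x) (hU : SmoothNear U x) (hV : SmoothNear V x) :
    mvfderiv I f x (VectorField.mlieBracket I U V x) =
      mvfderiv I (fun y ↦ mvfderiv I f y (V y)) x (U x)
        - mvfderiv I (fun y ↦ mvfderiv I f y (U y)) x (V x) := by
  have hmin : IsManifold I (minSmoothness ℝ 3) M := by
    rw [minSmoothness_of_isRCLikeNormedField]
    exact IsManifold.of_le (m := 3) (n := ∞) ENat.LEInfty.out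
  have hmin' : IsManifold I (minSmoothness ℝ 2) M := by
    rw [minSmoothness_of_isRCLikeNormedField]
    exact IsManifold.of_le (m := 2) (n := ∞) ENat.LEInfty.out
  have hle : minSmoothness ℝ 2 ≤ ∞ := by
    rw [minSmoothness_of_isRCLikeNormedField]; exact ENat.LEInfty.out
  -- The Jacobi identity for `U`, `V`, `fW` contains the claim as the coefficient of `W`: by the
  -- Leibniz rule, the terms with one derivative of `f` along `U` or `V` cancel, and those with none
  -- cancel by Jacobi for `W`.
  have key : ∀ w : TangentSpace I x, (mvfderiv I f x (VectorField.mlieBracket I U V x)) • w =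
      (mvfderiv I (fun y ↦ mvfderiv I f y (V y)) x (U x)
        - mvfderiv I (fun y ↦ mvfderiv I f y (U y)) x (V x)) • w := by
    intro w
    obtain ⟨W, hW, hw⟩ : ∃ W : Π y : M, TangentSpace I y, SmoothNear W x ∧ W x = w :=
      ⟨FiberBundle.extend E w, SmoothNear.extend w, by simp⟩
    have hfW : SmoothNear (f • W) x := SmoothNear.smul hf hW
    have br : ∀ Z : Π y : M, TangentSpace I y, ∀ᶠ y in 𝓝 x,
        VectorField.mlieBracket I Z (f • W) y =
          ((fun z ↦ mvfderiv I f z (Z z)) • W + f • VectorField.mlieBracket I Z W) y := by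
      intro Z
      filter_upwards [hf.eventually, hW.eventually] with y h1 h2
      rw [VectorField.mlieBracket_smul_right h1.mdiff h2.mdiff]
      rfl
    have jac := VectorField.leibniz_identity_mlieBracket_apply (hU.self_of_nhds.of_le hle)
      (hV.self_of_nhds.of_le hle) (hfW.self_of_nhds.of_le hle)
    have jac' := VectorField.leibniz_identity_mlieBracket_apply (hU.self_of_nhds.of_le hle)
      (hV.self_of_nhds.of_le hle) (hW.self_of_nhds.of_le hle)
    have expand : ∀ Y Z : Π y : M, TangentSpace I y, SmoothNear Y x → SmoothNear Z x →
        VectorField.mlieBracket I Y (VectorField.mlieBracket I Z (f • W)) x =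
          mvfderiv I (fun y ↦ mvfderiv I f y (Z y)) x (Y x) • W x
          + mvfderiv I f x (Z x) • VectorField.mlieBracket I Y W x
          + mvfderiv I f x (Y x) • VectorField.mlieBracket I Z W x
          + f x • VectorField.mlieBracket I Y (VectorField.mlieBracket I Z W) x := by
      intro Y Z hY hZ
      have a1 : SmoothNear ((fun z ↦ mvfderiv I f z (Z z)) • W) x :=
        SmoothNear.smul (hf.mvfderiv hZ) hW
      have a2 : SmoothNear (VectorField.mlieBracket I Z W) x := hZ.mlieBracket hW
      have a3 : SmoothNear (f • VectorField.mlieBracket I Z W) x := SmoothNear.smul hf a2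
      rw [mlieBracket_congr (Eventually.of_forall fun _ ↦ rfl) (br Z),
        VectorField.mlieBracket_add_right a1.mdiff a3.mdiff,
        VectorField.mlieBracket_smul_right (hf.mvfderiv hZ).mdiff hW.mdiff,
        VectorField.mlieBracket_smul_right hf.mdiff a2.mdiff]
      abel
    rw [expand U V hU hV, expand V U hV hU, (br _).self_of_nhds, jac'] at jac
    simp only [Pi.add_apply, Pi.smul_apply', hw, smul_add] at jac
    rw [sub_smul, eq_sub_iff_add_eq, ← sub_eq_zero]
    rw [← sub_eq_zero] at jac
    rw [← neg_eq_zero, ← jac]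
    abel
  by_cases h : ∃ w : TangentSpace I x, w ≠ 0
  · obtain ⟨w, hw⟩ := h
    exact smul_left_injective ℝ hw (key w)
  -- If the tangent space is zero there is no vector to test against, but then all three directions
  -- vanish.
  · push Not at h
    simp [h (VectorField.mlieBracket I U V x), h (U x), h (V x)]

variable [Bundle.RiemannianBundle (fun x : M ↦ TangentSpace I x)]
  [IsContMDiffRiemannianBundle I ∞ E (fun x : M ↦ TangentSpace I x)]

theorem leviCivita_congr {X Y : Π x : M, TangentSpace I x} {x : M} (hX : SmoothNear X x)
    (h : ∀ᶠ y in 𝓝 x, Y y = X y) : leviCivita Y x = leviCivita X x :=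
  leviCivita.isCovariantDerivativeOnUniv.congr_of_eventuallyEq (hX.congr h).mdiff hX.mdiff
    univ_mem h

theorem leviCivita_add_apply {X Y : Π x : M, TangentSpace I x} {x : M} (hX : SmoothNear X x)
    (hY : SmoothNear Y x) (v : TangentSpace I x) :
    leviCivita (fun y ↦ X y + Y y) x v = leviCivita X x v + leviCivita Y x v :=
  congrArg (· v) (leviCivita.isCovariantDerivativeOnUniv.add hX.mdiff hY.mdiff)

theorem leviCivita_smul_apply {f : M → ℝ} {X : Π x : M, TangentSpace I x} {x : M}
    (hf : SmoothFunNear I f x) (hX : SmoothNear X x) (v : TangentSpace I x) :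
    leviCivita (fun y ↦ f y • X y) x v = f x • leviCivita X x v + mvfderiv I f x v • X x :=
  congrArg (· v) (leviCivita.isCovariantDerivativeOnUniv.leibniz hX.mdiff hf.mdiff)

theorem leviCivita_sub_apply {X Y : Π x : M, TangentSpace I x} {x : M} (hX : SmoothNear X x)
    (hY : SmoothNear Y x) (v : TangentSpace I x) :
    leviCivita (fun y ↦ X y - Y y) x v = leviCivita X x v - leviCivita Y x v := by
  have h := leviCivita_add_apply (hX.sub hY) hY v
  rw [eq_sub_iff_add_eq, ← h]
  simp

theorem leviCivita_zero_apply {x : M} (v : TangentSpace I x) :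
    leviCivita (fun y ↦ (0 : TangentSpace I y)) x v = 0 := by
  have h := leviCivita_add_apply (SmoothNear.zero (I := I) x) (SmoothNear.zero x) v
  simpa using h

theorem leviCivita_sum_apply {ι : Type*} {s : Finset ι} {X : ι → Π x : M, TangentSpace I x} {x : M}
    (hX : ∀ i ∈ s, SmoothNear (X i) x) (v : TangentSpace I x) :
    leviCivita (fun y ↦ ∑ i ∈ s, X i y) x v = ∑ i ∈ s, leviCivita (X i) x v := by
  classical
  induction s using Finset.induction_on with
  | empty => simpa using leviCivita_zero_apply v
  | insert a s ha ih =>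
    simp only [Finset.sum_insert ha]
    rw [leviCivita_add_apply (hX a (by simp)) (SmoothNear.sum fun i hi ↦ hX i (by simp [hi])),
      ih fun i hi ↦ hX i (by simp [hi])]

theorem mvfderiv_inner {Y Z : Π x : M, TangentSpace I x} {x : M} (hY : SmoothNear Y x)
    (hZ : SmoothNear Z x) (v : TangentSpace I x) :
    mvfderiv I (fun y ↦ inner ℝ (Y y) (Z y)) x v =
      inner ℝ (leviCivita Y x v) (Z x) + inner ℝ (Y x) (leviCivita Z x v) := by
  have h := leviCivita_metric (SmoothNear.extend v).mdiff hY.mdiff hZ.mdiff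
  simpa using h

theorem mlieBracket_eq {X Y : Π x : M, TangentSpace I x} {x : M} (hX : SmoothNear X x)
    (hY : SmoothNear Y x) : VectorField.mlieBracket I X Y x =
      leviCivita Y x (X x) - leviCivita X x (Y x) := by
  have h := leviCivita_torsion (I := I) (M := M)
  rw [CovariantDerivative.torsion_eq_zero_iff] at h
  exact (h hX.mdiff hY.mdiff).symm

/-- The curvature operator on vector fields. -/
def fieldCurvature (U V W : Π x : M, TangentSpace I x) (x : M) : TangentSpace I x :=
  leviCivita (fun y ↦ leviCivita W y (V y)) x (U x)
    - leviCivita (fun y ↦ leviCivita W y (U y)) x (V x)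
    - leviCivita W x (VectorField.mlieBracket I U V x)

theorem curvature_eq_fieldCurvature (x : M) (u v w : TangentSpace I x) :
    curvature x u v w = fieldCurvature (FiberBundle.extend E u) (FiberBundle.extend E v)
      (FiberBundle.extend E w) x := by
  simp [curvature, fieldCurvature]

/-- Differentiate the function `⟨W, Z⟩` along `[U, V] = UV - VU`. By metric compatibility the mixed
products of first derivatives are symmetric in `U`, `V` and cancel. -/
theorem inner_fieldCurvature_antisymm {U V W Z : Π x : M, TangentSpace I x} {x : M}
    (hU : SmoothNear U x) (hV : SmoothNear V x) (hW : SmoothNear W x) (hZ : SmoothNear Z x) :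
    inner ℝ (fieldCurvature U V W x) (Z x) = - inner ℝ (W x) (fieldCurvature U V Z x) := by
  have h := mvfderiv_mlieBracket (hW.inner hZ) hU hV
  have second : ∀ X Y : Π x : M, TangentSpace I x, SmoothNear X x → SmoothNear Y x →
      mvfderiv I (fun y ↦ mvfderiv I (fun z ↦ inner ℝ (W z) (Z z)) y (Y y)) x (X x) =
        (inner ℝ (leviCivita (fun y ↦ leviCivita W y (Y y)) x (X x)) (Z x)
          + inner ℝ (leviCivita W x (Y x)) (leviCivita Z x (X x)))
        + (inner ℝ (leviCivita W x (X x)) (leviCivita Z x (Y x))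
          + inner ℝ (W x) (leviCivita (fun y ↦ leviCivita Z y (Y y)) x (X x))) := by
    intro X Y hX hY
    have e : ∀ᶠ y in 𝓝 x, mvfderiv I (fun z ↦ inner ℝ (W z) (Z z)) y (Y y) =
        inner ℝ (leviCivita W y (Y y)) (Z y) + inner ℝ (W y) (leviCivita Z y (Y y)) := by
      filter_upwards [hW.eventually, hZ.eventually] with y h1 h2 using mvfderiv_inner h1 h2 _
    have a1 := (hW.leviCivita hY)
    have a2 := (hZ.leviCivita hY)
    rw [mvfderiv_congr e, mvfderiv_fun_add (a1.inner hZ).mdiff (hW.inner a2).mdiff,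
      add_apply, mvfderiv_inner a1 hZ, mvfderiv_inner hW a2]
  rw [second U V hU hV, second V U hV hU, mvfderiv_inner hW hZ] at h
  simp only [fieldCurvature, inner_sub_left, inner_sub_right]
  linarith

/-- The curvature depends on the last field only through its value. -/
theorem fieldCurvature_congr {U V W W' : Π x : M, TangentSpace I x} {x : M}
    (hU : SmoothNear U x) (hV : SmoothNear V x) (hW : SmoothNear W x) (hW' : SmoothNear W' x)
    (h : W x = W' x) : fieldCurvature U V W x = fieldCurvature U V W' x := by
  refine ext_inner_right ℝ fun z ↦ ?_
  have hZ := SmoothNear.extend z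
  -- Antisymmetry moves the curvature onto the test field, so that `W` enters only through its
  -- value.
  have h1 := inner_fieldCurvature_antisymm hU hV hW hZ
  have h2 := inner_fieldCurvature_antisymm hU hV hW' hZ
  simp only [FiberBundle.extend_apply_self] at h1 h2
  rw [h1, h2, h]

theorem fieldCurvature_swap (U V W : Π x : M, TangentSpace I x) (x : M) :
    fieldCurvature U V W x = - fieldCurvature V U W x := by
  simp only [fieldCurvature]
  rw [VectorField.mlieBracket_swap_apply, map_neg]
  abel

/-- With zero torsion every double bracket is a combination of covariant derivatives, and the Jacobi
identity turns into the first Bianchi identity. -/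
theorem fieldCurvature_bianchi {U V W : Π x : M, TangentSpace I x} {x : M}
    (hU : SmoothNear U x) (hV : SmoothNear V x) (hW : SmoothNear W x) :
    fieldCurvature U V W x + fieldCurvature V W U x + fieldCurvature W U V x = 0 := by
  have hmin : IsManifold I (minSmoothness ℝ 3) M := by
    rw [minSmoothness_of_isRCLikeNormedField]
    exact IsManifold.of_le (m := 3) (n := ∞) ENat.LEInfty.out
  have hle : minSmoothness ℝ 2 ≤ ∞ := by
    rw [minSmoothness_of_isRCLikeNormedField]; exact ENat.LEInfty.out
  have jac := VectorField.leibniz_identity_mlieBracket_apply (hU.self_of_nhds.of_le hle)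
    (hV.self_of_nhds.of_le hle) (hW.self_of_nhds.of_le hle)
  have br : ∀ X Y Z : Π x : M, TangentSpace I x, SmoothNear X x → SmoothNear Y x →
      SmoothNear Z x → VectorField.mlieBracket I X (VectorField.mlieBracket I Y Z) x =
        leviCivita (fun y ↦ leviCivita Z y (Y y)) x (X x)
          - leviCivita (fun y ↦ leviCivita Y y (Z y)) x (X x)
          - leviCivita X x (VectorField.mlieBracket I Y Z x) := by
    intro X Y Z hX hY hZ
    have e : ∀ᶠ y in 𝓝 x, VectorField.mlieBracket I Y Z y =
        leviCivita Z y (Y y) - leviCivita Y y (Z y) := by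
      filter_upwards [hY.eventually, hZ.eventually] with y h1 h2 using mlieBracket_eq h1 h2
    rw [mlieBracket_eq hX (hY.mlieBracket hZ),
      leviCivita_congr ((hZ.leviCivita hY).sub (hY.leviCivita hZ)) e,
      leviCivita_sub_apply (hZ.leviCivita hY) (hY.leviCivita hZ)]
  rw [VectorField.mlieBracket_swap_apply (V := VectorField.mlieBracket I U V), br U V W hU hV hW,
    br W U V hW hU hV, br V U W hV hU hW] at jac
  simp only [fieldCurvature]
  rw [VectorField.mlieBracket_swap_apply (V := W) (W := U), map_neg]
  rw [← sub_eq_zero] at jac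
  rw [← jac]
  abel

/-- The Ricci tensor is symmetric. -/
theorem ricci_comm (x : M) (v w : TangentSpace I x) : ricci x v w = ricci x w v := by
  unfold ricci
  refine Finset.sum_congr rfl fun i _ ↦ ?_
  set e := stdOrthonormalBasis ℝ (TangentSpace I x) i
  have hE := SmoothNear.extend e
  have hV := SmoothNear.extend v
  have hW := SmoothNear.extend w
  have h1 := fieldCurvature_bianchi hE hV hW
  -- This says `⟨R(v, w)e, e⟩ = 0`, so the Bianchi identity paired with `e` leaves just the two
  -- Ricci summands; the full pair symmetry is not needed.
  have h2 := inner_fieldCurvature_antisymm hV hW hE hE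
  rw [fieldCurvature_swap (FiberBundle.extend E w)] at h1
  rw [real_inner_comm] at h2
  simp only [FiberBundle.extend_apply_self] at h2
  rw [curvature_eq_fieldCurvature, curvature_eq_fieldCurvature, ← sub_eq_zero, ← inner_sub_left]
  have h3 := congrArg (fun z ↦ inner ℝ z e) h1
  simp only [inner_add_left, inner_neg_left, inner_zero_left] at h3
  rw [real_inner_comm] at h2
  rw [inner_sub_left]
  linarith

end Curvature

/-! ### The Weitzenböck and Bochner formulas for a real vector field. -/

section Weitzenbock

variable {E : Type*} [NormedAddCommGroup E] [NormedSpace ℝ E] [FiniteDimensional ℝ E]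
  {H : Type*} [TopologicalSpace H] {I : ModelWithCorners ℝ E H}
  {M : Type*} [TopologicalSpace M] [ChartedSpace H M] [IsManifold I ∞ M]
  [Bundle.RiemannianBundle (fun x : M ↦ TangentSpace I x)]
  [IsContMDiffRiemannianBundle I ∞ E (fun x : M ↦ TangentSpace I x)]

/-- The exterior derivative of the `1`-form dual to the vector field `X`. -/
def curl (X : Π x : M, TangentSpace I x) (x : M) (v w : TangentSpace I x) : ℝ :=
  inner ℝ (leviCivita X x v) w - inner ℝ (leviCivita X x w) v

/-- The divergence of a real vector field. -/
def realDivergence (X : Π x : M, TangentSpace I x) (x : M) : ℝ :=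
  ∑ i, inner ℝ (leviCivita X x (stdOrthonormalBasis ℝ (TangentSpace I x) i))
    (stdOrthonormalBasis ℝ (TangentSpace I x) i)

/-- The second covariant derivative `∇_v ∇_V A - ∇_{∇_v V} A`. -/
def secondCovDeriv (A V : Π x : M, TangentSpace I x) (x : M) (v : TangentSpace I x) :
    TangentSpace I x :=
  leviCivita (fun y ↦ leviCivita A y (V y)) x v - leviCivita A x (leviCivita V x v)

theorem mvfderiv_inner_leviCivita {A V W : Π x : M, TangentSpace I x} {x : M}
    (hA : SmoothNear A x) (hV : SmoothNear V x) (hW : SmoothNear W x) (v : TangentSpace I x) :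
    mvfderiv I (fun y ↦ inner ℝ (leviCivita A y (V y)) (W y)) x v =
      inner ℝ (secondCovDeriv A V x v) (W x) + inner ℝ (leviCivita A x (leviCivita V x v)) (W x)
        + inner ℝ (leviCivita A x (V x)) (leviCivita W x v) := by
  rw [mvfderiv_inner (hA.leviCivita hV) hW, secondCovDeriv, inner_sub_left]
  ring

/-- Metric compatibility produces the extra terms `⟨X, ∇_V W - ∇_W V⟩`, which the bracket term
removes because the torsion is zero. -/
theorem extDeriv_eq_curl {α : Π x : M, TangentSpace I x →L[ℝ] ℝ} {X : Π x : M, TangentSpace I x}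
    {x : M} (hX : SmoothNear X x) (h : ∀ y v, α y v = inner ℝ (X y) v) (v w : TangentSpace I x) :
    extDeriv α x v w = curl X x v w := by
  have hV := SmoothNear.extend v
  have hW := SmoothNear.extend w
  simp only [extDeriv, h, curl]
  rw [mvfderiv_inner hX hW, mvfderiv_inner hX hV, mlieBracket_eq hV hW, inner_sub_right]
  simp only [FiberBundle.extend_apply_self]
  ring

theorem covDerivTwoForm_curl {A : Π x : M, TangentSpace I x} {x : M} (hA : SmoothNear A x)
    (v u w : TangentSpace I x) :
    covDerivTwoForm (curl A) x v u w =
      inner ℝ (secondCovDeriv A (FiberBundle.extend E u) x v) w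
        - inner ℝ (secondCovDeriv A (FiberBundle.extend E w) x v) u := by
  have hU := SmoothNear.extend u
  have hW := SmoothNear.extend w
  have h1 := ((hA.leviCivita hU).inner hW).mdiff
  have h2 := ((hA.leviCivita hW).inner hU).mdiff
  simp only [covDerivTwoForm, curl]
  rw [mvfderiv_fun_sub h1 h2, sub_apply, mvfderiv_inner_leviCivita hA hU hW,
    mvfderiv_inner_leviCivita hA hW hU]
  simp only [FiberBundle.extend_apply_self]
  ring

/-- The Ricci identity: `[U, V] = ∇_U V - ∇_V U` matches the correction terms of the second
derivatives with the bracket term of the curvature. -/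
theorem secondCovDeriv_swap {A U V : Π x : M, TangentSpace I x} {x : M}
    (hU : SmoothNear U x) (hV : SmoothNear V x) :
    secondCovDeriv A V x (U x) = secondCovDeriv A U x (V x) + fieldCurvature U V A x := by
  simp only [secondCovDeriv, fieldCurvature]
  rw [mlieBracket_eq hU hV, map_sub]
  abel

/-- Tensoriality in `V`: the derivatives of the coefficients occur in both terms of `secondCovDeriv`
and cancel. -/
theorem secondCovDeriv_sum {ι : Type*} {s : Finset ι} {A : Π x : M, TangentSpace I x}
    {g : ι → M → ℝ} {V : ι → Π x : M, TangentSpace I x} {x : M} (hA : SmoothNear A x)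
    (hg : ∀ i ∈ s, SmoothFunNear I (g i) x) (hV : ∀ i ∈ s, SmoothNear (V i) x)
    (v : TangentSpace I x) :
    secondCovDeriv A (fun y ↦ ∑ i ∈ s, g i y • V i y) x v =
      ∑ i ∈ s, g i x • secondCovDeriv A (V i) x v := by
  simp only [secondCovDeriv, map_sum, map_smul]
  rw [leviCivita_sum_apply fun i hi ↦ SmoothNear.smul (hg i hi) (hA.leviCivita (hV i hi)),
    leviCivita_sum_apply fun i hi ↦ SmoothNear.smul (hg i hi) (hV i hi), map_sum,
    ← Finset.sum_sub_distrib]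
  refine Finset.sum_congr rfl fun i hi ↦ ?_
  rw [leviCivita_smul_apply (hg i hi) (hA.leviCivita (hV i hi)),
    leviCivita_smul_apply (hg i hi) (hV i hi), map_add, map_smul, map_smul, smul_sub]
  abel

theorem secondCovDeriv_congr_of_eventually {A V V' : Π x : M, TangentSpace I x} {x : M}
    (hA : SmoothNear A x) (hV : SmoothNear V x) (h : ∀ᶠ y in 𝓝 x, V' y = V y)
    (v : TangentSpace I x) : secondCovDeriv A V' x v = secondCovDeriv A V x v := by
  have h' : ∀ᶠ y in 𝓝 x, leviCivita A y (V' y) = leviCivita A y (V y) := by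
    filter_upwards [h] with y hy
    rw [hy]
  rw [secondCovDeriv, secondCovDeriv, leviCivita_congr (hA.leviCivita hV) h',
    leviCivita_congr hV h]

/-- In a smooth orthonormal frame the second covariant derivative is the linear combination of the
second covariant derivatives along the frame. -/
theorem secondCovDeriv_eq_sum_frame {A V : Π x : M, TangentSpace I x} {x : M}
    (hA : SmoothNear A x) (hV : SmoothNear V x)
    {e : Fin (Module.finrank ℝ E) → Π y : M, TangentSpace I y} (he : ∀ i, SmoothNear (e i) x)
    (hb : ∀ᶠ y in 𝓝 x, ∃ b : OrthonormalBasis (Fin (Module.finrank ℝ E)) ℝ (TangentSpace I y),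
        ∀ i, b i = e i y) (v : TangentSpace I x) :
    secondCovDeriv A V x v = ∑ i, (inner ℝ (e i x) (V x) : ℝ) • secondCovDeriv A (e i) x v := by
  have hg : ∀ i ∈ Finset.univ, SmoothFunNear I (fun y ↦ inner ℝ (e i y) (V y)) x :=
    fun i _ ↦ (he i).inner hV
  rw [← secondCovDeriv_sum hA hg fun i _ ↦ he i]
  refine secondCovDeriv_congr_of_eventually hA
    (SmoothNear.sum fun i hi ↦ SmoothNear.smul (hg i hi) (he i)) ?_ v
  filter_upwards [hb] with y ⟨b, hy⟩
  simp only [← hy]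
  exact (b.sum_repr' (V y)).symm

/-- A trace may be computed in any orthonormal basis. This lets a smooth frame replace
`stdOrthonormalBasis`, which is chosen separately at each point and cannot be differentiated. -/
theorem realDivergence_eq {ι : Type*} [Fintype ι] (X : Π x : M, TangentSpace I x) (x : M)
    (b : OrthonormalBasis ι ℝ (TangentSpace I x)) :
    realDivergence X x = ∑ i, inner ℝ (leviCivita X x (b i)) (b i) := by
  have h1 := LinearMap.trace_eq_sum_inner
    (leviCivita X x : TangentSpace I x →ₗ[ℝ] TangentSpace I x) b
  have h2 := LinearMap.trace_eq_sum_inner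
    (leviCivita X x : TangentSpace I x →ₗ[ℝ] TangentSpace I x)
    (stdOrthonormalBasis ℝ (TangentSpace I x))
  rw [h1] at h2
  simp only [ContinuousLinearMap.coe_coe] at h2
  simp only [realDivergence, real_inner_comm]
  exact h2.symm

theorem eventually_realDivergence_eq {x : M} (A : Π x : M, TangentSpace I x)
    {e : Fin (Module.finrank ℝ E) → Π y : M, TangentSpace I y}
    (hb : ∀ᶠ y in 𝓝 x, ∃ b : OrthonormalBasis (Fin (Module.finrank ℝ E)) ℝ (TangentSpace I y),
        ∀ i, b i = e i y) :
    ∀ᶠ y in 𝓝 x, realDivergence A y = ∑ i, inner ℝ (leviCivita A y (e i y)) (e i y) := by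
  filter_upwards [hb] with y ⟨b, hy⟩
  rw [realDivergence_eq A y b]
  simp only [hy]

protected theorem SmoothNear.realDivergence {A : Π x : M, TangentSpace I x} {x : M} (hA : SmoothNear A x) :
    SmoothFunNear I (realDivergence A) x := by
  obtain ⟨e, he, hb⟩ := exists_orthonormal_frame I x
  exact (SmoothFunNear.sum fun i _ ↦ (hA.leviCivita (he i)).inner (he i)).congr
    (eventually_realDivergence_eq A hb)

theorem mvfderiv_sum {ι : Type*} {s : Finset ι} {f : ι → M → ℝ} {x : M}
    (hf : ∀ i ∈ s, SmoothFunNear I (f i) x) (v : TangentSpace I x) :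
    mvfderiv I (fun y ↦ ∑ i ∈ s, f i y) x v = ∑ i ∈ s, mvfderiv I (f i) x v := by
  classical
  induction s using Finset.induction_on with
  | empty => simp [mvfderiv_const]
  | insert a s ha ih =>
    simp only [Finset.sum_insert ha]
    rw [mvfderiv_fun_add (hf a (by simp)).mdiff
      (SmoothFunNear.sum fun i hi ↦ hf i (by simp [hi])).mdiff, add_apply,
      ih fun i hi ↦ hf i (by simp [hi])]

/-- The divergence commutes with covariant differentiation. -/
theorem mvfderiv_realDivergence {A : Π x : M, TangentSpace I x} {x : M} (hA : SmoothNear A x)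
    (w : TangentSpace I x) :
    mvfderiv I (realDivergence A) x w =
      ∑ i, inner ℝ (secondCovDeriv A
        (FiberBundle.extend E (stdOrthonormalBasis ℝ (TangentSpace I x) i)) x w)
        (stdOrthonormalBasis ℝ (TangentSpace I x) i) := by
  obtain ⟨e, he, hb⟩ := exists_orthonormal_frame I x
  obtain ⟨b, hbx⟩ := hb.self_of_nhds
  -- The functions `⟨eᵢ, eⱼ⟩` are constant near `x`, so the connection matrix of the frame is skew.
  have skew : ∀ i j, inner ℝ (leviCivita (e i) x w) (e j x)
      = - inner ℝ (leviCivita (e j) x w) (e i x) := by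
    intro i j
    have h1 := mvfderiv_inner (he i) (he j) w
    have h2 : ∀ᶠ y in 𝓝 x, inner ℝ (e i y) (e j y) = if i = j then (1 : ℝ) else 0 := by
      filter_upwards [hb] with y ⟨b, hy⟩
      simp only [← hy]
      exact b.inner_eq_ite i j
    rw [mvfderiv_congr h2, mvfderiv_const, zero_apply] at h1
    rw [real_inner_comm (leviCivita (e j) x w)] at h1
    linarith
  have exp : ∀ i, leviCivita (e i) x w = ∑ j, (inner ℝ (e j x) (leviCivita (e i) x w) : ℝ) • e j x := by
    intro i
    simp only [← hbx]
    exact (b.sum_repr' _).symm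
  -- The error from differentiating the frame pairs the skew connection matrix with the symmetric
  -- part of `∇A`, hence vanishes.
  have cancel : ∑ i, (inner ℝ (leviCivita A x (leviCivita (e i) x w)) (e i x)
      + inner ℝ (leviCivita A x (e i x)) (leviCivita (e i) x w)) = 0 := by
    rw [Finset.sum_add_distrib]
    have c1 : ∑ i, inner ℝ (leviCivita A x (leviCivita (e i) x w)) (e i x) =
        ∑ i, ∑ j, inner ℝ (e j x) (leviCivita (e i) x w) * inner ℝ (leviCivita A x (e j x)) (e i x) := by
      refine Finset.sum_congr rfl fun i _ ↦ ?_
      conv_lhs => rw [exp i]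
      simp [map_sum, sum_inner, inner_smul_left]
    have c2 : ∑ i, inner ℝ (leviCivita A x (e i x)) (leviCivita (e i) x w) =
        ∑ i, ∑ j, inner ℝ (e j x) (leviCivita (e i) x w) * inner ℝ (leviCivita A x (e i x)) (e j x) := by
      refine Finset.sum_congr rfl fun i _ ↦ ?_
      conv_lhs => rw [exp i]
      simp [inner_sum, inner_smul_right]
    rw [c1, c2, Finset.sum_comm, ← Finset.sum_add_distrib]
    refine Finset.sum_eq_zero fun i _ ↦ ?_
    rw [← Finset.sum_add_distrib]
    refine Finset.sum_eq_zero fun j _ ↦ ?_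
    have := skew i j
    rw [real_inner_comm (leviCivita (e j) x w) (e i x), real_inner_comm (leviCivita (e i) x w) (e j x),
      this]
    ring
  have step : mvfderiv I (realDivergence A) x w =
      ∑ i, inner ℝ (secondCovDeriv A (e i) x w) (e i x) := by
    rw [mvfderiv_congr (eventually_realDivergence_eq A hb),
      mvfderiv_sum fun i _ ↦ (hA.leviCivita (he i)).inner (he i), ← sub_eq_zero,
      ← Finset.sum_sub_distrib, ← cancel]
    refine Finset.sum_congr rfl fun i _ ↦ ?_
    rw [mvfderiv_inner_leviCivita hA (he i) (he i)]
    ring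
  rw [step]
  -- By tensoriality the trace over the frame agrees with the trace over extensions of the standard
  -- basis; Parseval's identity then compares the two bases.
  have rhs : ∀ i, inner ℝ (secondCovDeriv A
        (FiberBundle.extend E (stdOrthonormalBasis ℝ (TangentSpace I x) i)) x w)
        (stdOrthonormalBasis ℝ (TangentSpace I x) i) =
      ∑ j, inner ℝ (e j x) (stdOrthonormalBasis ℝ (TangentSpace I x) i) *
        inner ℝ (secondCovDeriv A (e j) x w) (stdOrthonormalBasis ℝ (TangentSpace I x) i) := by
    intro i
    rw [secondCovDeriv_eq_sum_frame hA (SmoothNear.extend _) he hb w]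
    simp [sum_inner, inner_smul_left]
  simp only [rhs]
  rw [Finset.sum_comm]
  refine Finset.sum_congr rfl fun j _ ↦ ?_
  rw [← (stdOrthonormalBasis ℝ (TangentSpace I x)).sum_inner_mul_inner]
  refine Finset.sum_congr rfl fun i _ ↦ ?_
  rw [real_inner_comm (e j x), mul_comm]

/-- The Weitzenböck formula for `1`-forms. -/
theorem sum_inner_secondCovDeriv {A : Π x : M, TangentSpace I x} {x : M} (hA : SmoothNear A x)
    (w : TangentSpace I x) :
    ∑ i, inner ℝ (secondCovDeriv A
        (FiberBundle.extend E (stdOrthonormalBasis ℝ (TangentSpace I x) i)) x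
        (stdOrthonormalBasis ℝ (TangentSpace I x) i)) w =
      mvfderiv I (realDivergence A) x w + ricci x w (A x) - codifferential (curl A) x w := by
  rw [mvfderiv_realDivergence hA, ricci, codifferential, sub_neg_eq_add, ← Finset.sum_add_distrib,
    ← Finset.sum_add_distrib]
  refine Finset.sum_congr rfl fun i _ ↦ ?_
  set e := stdOrthonormalBasis ℝ (TangentSpace I x) i
  have hE := SmoothNear.extend e
  have hW := SmoothNear.extend w
  have h1 := secondCovDeriv_swap (A := A) hE hW
  simp only [FiberBundle.extend_apply_self] at h1
  rw [covDerivTwoForm_curl hA, curvature_eq_fieldCurvature,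
    fieldCurvature_congr hE hW (SmoothNear.extend (A x)) hA (by simp), h1, inner_add_left]
  ring

/-- The Bochner formula for half the squared norm of a field `A`, whose gradient is `G`. -/
theorem realDivergence_gradient_normSq {A G : Π x : M, TangentSpace I x} {x : M}
    (hA : SmoothNear A x) (hG : SmoothNear G x)
    (h : ∀ᶠ y in 𝓝 x, ∀ v, inner ℝ (G y) v = inner ℝ (leviCivita A y v) (A y)) :
    realDivergence G x =
      ∑ i, ‖leviCivita A x (stdOrthonormalBasis ℝ (TangentSpace I x) i)‖ ^ 2
        + mvfderiv I (realDivergence A) x (A x) + ricci x (A x) (A x)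
        - codifferential (curl A) x (A x) := by
  have h1 := sum_inner_secondCovDeriv hA (A x)
  have h2 : realDivergence G x =
      ∑ i, (‖leviCivita A x (stdOrthonormalBasis ℝ (TangentSpace I x) i)‖ ^ 2
        + inner ℝ (secondCovDeriv A
        (FiberBundle.extend E (stdOrthonormalBasis ℝ (TangentSpace I x) i)) x
        (stdOrthonormalBasis ℝ (TangentSpace I x) i)) (A x)) := by
    refine Finset.sum_congr rfl fun i _ ↦ ?_
    set e := stdOrthonormalBasis ℝ (TangentSpace I x) i
    have hE := SmoothNear.extend e
    -- The derivative of `⟨G, E⟩ = ⟨∇_E A, A⟩` along `e` is computed from both expressions; the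
    -- terms in `∇_e E` agree by the relation at `x`.
    have h3 := mvfderiv_inner hG hE e
    have h4 := mvfderiv_inner_leviCivita hA hE hA e
    have h5 : ∀ᶠ y in 𝓝 x, inner ℝ (G y) (FiberBundle.extend E e y) =
        inner ℝ (leviCivita A y (FiberBundle.extend E e y)) (A y) := by
      filter_upwards [h] with y hy using hy _
    rw [mvfderiv_congr h5, h4, h.self_of_nhds] at h3
    simp only [FiberBundle.extend_apply_self] at h3
    rw [real_inner_self_eq_norm_sq] at h3
    linarith
  rw [h2, Finset.sum_add_distrib, h1]
  ring

end Weitzenbock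

/-! ### The magnetic Bochner formula for real and imaginary parts. -/

section Magnetic

variable {E : Type*} [NormedAddCommGroup E] [NormedSpace ℝ E] [FiniteDimensional ℝ E]
  {H : Type*} [TopologicalSpace H] {I : ModelWithCorners ℝ E H}
  {M : Type*} [TopologicalSpace M] [ChartedSpace H M] [IsManifold I ∞ M]
  [Bundle.RiemannianBundle (fun x : M ↦ TangentSpace I x)]
  [IsContMDiffRiemannianBundle I ∞ E (fun x : M ↦ TangentSpace I x)]

/-- This is `d² = 0`: the commutator of the second derivatives of `φ` is the derivative along the
bracket, and the torsion is zero. -/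
theorem curl_gradient {φ : M → ℝ} {G : Π x : M, TangentSpace I x} {x : M}
    (hφ : SmoothFunNear I φ x) (hG : SmoothNear G x)
    (h : ∀ᶠ y in 𝓝 x, ∀ v, inner ℝ (G y) v = mvfderiv I φ y v) (v w : TangentSpace I x) :
    curl G x v w = 0 := by
  have hV := SmoothNear.extend v
  have hW := SmoothNear.extend w
  have d : ∀ Z : Π x : M, TangentSpace I x, ∀ᶠ y in 𝓝 x,
      inner ℝ (G y) (Z y) = mvfderiv I φ y (Z y) := fun Z ↦ by
    filter_upwards [h] with y hy using hy _
  have h1 := mvfderiv_mlieBracket hφ hV hW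
  rw [← mvfderiv_congr (d _), ← mvfderiv_congr (d _), ← h.self_of_nhds, mvfderiv_inner hG hW,
    mvfderiv_inner hG hV, mlieBracket_eq hV hW, inner_sub_right] at h1
  simp only [FiberBundle.extend_apply_self] at h1
  rw [curl]
  linarith

/-- Here `A - fN` is the gradient of `φ`, hence curl-free, and the product rule gives `d(fN♭) = f
dN♭ + df ∧ N♭`. -/
theorem curl_of_gradient_sub_smul {φ f : M → ℝ} {A N F : Π x : M, TangentSpace I x} {x : M}
    (hφ : SmoothFunNear I φ x) (hf : SmoothFunNear I f x) (hA : SmoothNear A x)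
    (hN : SmoothNear N x)
    (h : ∀ᶠ y in 𝓝 x, ∀ v, inner ℝ (A y) v = mvfderiv I φ y v + f y * inner ℝ (N y) v)
    (hF : ∀ v, inner ℝ (F x) v = mvfderiv I f x v) (v w : TangentSpace I x) :
    curl A x v w = f x * curl N x v w + inner ℝ (F x) v * inner ℝ (N x) w
      - inner ℝ (F x) w * inner ℝ (N x) v := by
  have hfN := SmoothNear.smul hf hN
  have h1 := curl_gradient hφ (hA.sub hfN) (by
    filter_upwards [h] with y hy
    intro v
    rw [inner_sub_left, hy, inner_smul_left]
    simp) v w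
  simp only [curl] at h1 ⊢
  rw [leviCivita_sub_apply hA hfN, leviCivita_sub_apply hA hfN, leviCivita_smul_apply hf hN,
    leviCivita_smul_apply hf hN] at h1
  simp only [inner_sub_left, inner_add_left, inner_smul_left, ← hF] at h1
  simp only [conj_trivial] at h1
  linarith

theorem covDerivTwoForm_congr {β β' : Π x : M, TangentSpace I x → TangentSpace I x → ℝ} {x : M}
    (h : ∀ᶠ y in 𝓝 x, ∀ v w, β y v w = β' y v w) (v u w : TangentSpace I x) :
    covDerivTwoForm β x v u w = covDerivTwoForm β' x v u w := by
  have h1 : ∀ᶠ y in 𝓝 x, β y (FiberBundle.extend E u y) (FiberBundle.extend E w y) =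
      β' y (FiberBundle.extend E u y) (FiberBundle.extend E w y) := by
    filter_upwards [h] with y hy using hy _ _
  simp only [covDerivTwoForm, mvfderiv_congr h1, h.self_of_nhds]

theorem codifferential_congr {β β' : Π x : M, TangentSpace I x → TangentSpace I x → ℝ} {x : M}
    (h : ∀ᶠ y in 𝓝 x, ∀ v w, β y v w = β' y v w) (w : TangentSpace I x) :
    codifferential β x w = codifferential β' x w := by
  simp only [codifferential, covDerivTwoForm_congr h]

theorem covDerivTwoForm_smul_curl_add_wedge {f : M → ℝ} {X N : Π x : M, TangentSpace I x} {x : M}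
    (hf : SmoothFunNear I f x) (hX : SmoothNear X x) (hN : SmoothNear N x)
    (v u w : TangentSpace I x) :
    covDerivTwoForm (fun y p q ↦ f y * curl N y p q
        + (inner ℝ (X y) p * inner ℝ (N y) q - inner ℝ (X y) q * inner ℝ (N y) p)) x v u w =
      f x * covDerivTwoForm (curl N) x v u w + mvfderiv I f x v * curl N x u w
        + (inner ℝ (leviCivita X x v) u * inner ℝ (N x) w
          + inner ℝ (X x) u * inner ℝ (leviCivita N x v) w
          - inner ℝ (leviCivita X x v) w * inner ℝ (N x) u
          - inner ℝ (X x) w * inner ℝ (leviCivita N x v) u) := by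
  have hU := SmoothNear.extend u
  have hW := SmoothNear.extend w
  have hc : SmoothFunNear I
      (fun y ↦ curl N y (FiberBundle.extend E u y) (FiberBundle.extend E w y)) x :=
    ((hN.leviCivita hU).inner hW).sub ((hN.leviCivita hW).inner hU)
  simp only [covDerivTwoForm]
  rw [mvfderiv_fun_add (hf.mul hc).mdiff
      (((hX.inner hU).mul (hN.inner hW)).sub ((hX.inner hW).mul (hN.inner hU))).mdiff,
    mvfderiv_fun_sub ((hX.inner hU).mul (hN.inner hW)).mdiff
      ((hX.inner hW).mul (hN.inner hU)).mdiff,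
    mvfderiv_fun_mul hf.mdiff hc.mdiff,
    mvfderiv_fun_mul (hX.inner hU).mdiff (hN.inner hW).mdiff,
    mvfderiv_fun_mul (hX.inner hW).mdiff (hN.inner hU).mdiff]
  simp only [add_apply, sub_apply, smul_apply, smul_eq_mul, mvfderiv_inner hX hU,
    mvfderiv_inner hX hW, mvfderiv_inner hN hU, mvfderiv_inner hN hW,
    FiberBundle.extend_apply_self]
  ring

theorem sum_inner_mul_map {V ι : Type*} [NormedAddCommGroup V] [InnerProductSpace ℝ V]
    [Fintype ι] (b : OrthonormalBasis ι ℝ V) (T : V →ₗ[ℝ] ℝ) (v : V) :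
    ∑ i, inner ℝ v (b i) * T (b i) = T v := by
  conv_rhs => rw [← b.sum_repr' v]
  simp [map_sum, real_inner_comm]

/-- The two-form has the shape shared by the curls of `A` and `B`. After the product rule, every sum
over the basis is either a divergence, the codifferential of `curl N`, or an expansion of a vector
that `sum_inner_mul_map` collapses. -/
theorem codifferential_smul_curl_add_wedge {f : M → ℝ} {X N F : Π x : M, TangentSpace I x} {x : M}
    (hf : SmoothFunNear I f x) (hX : SmoothNear X x) (hN : SmoothNear N x)
    (hF : ∀ v, inner ℝ (F x) v = mvfderiv I f x v) (w : TangentSpace I x) :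
    -codifferential (fun y p q ↦ f y * curl N y p q
        + (inner ℝ (X y) p * inner ℝ (N y) q - inner ℝ (X y) q * inner ℝ (N y) p)) x w =
      -(f x * codifferential (curl N) x w) + curl N x (F x) w
        + realDivergence X x * inner ℝ (N x) w + inner ℝ (leviCivita N x (X x)) w
        - inner ℝ (leviCivita X x (N x)) w - realDivergence N x * inner ℝ (X x) w := by
  simp only [codifferential, covDerivTwoForm_smul_curl_add_wedge hf hX hN, neg_neg, ← hF,
    mul_neg, realDivergence, Finset.sum_mul, Finset.mul_sum]
  have e1 := sum_inner_mul_map (stdOrthonormalBasis ℝ (TangentSpace I x))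
    (((innerSL ℝ).flip w).toLinearMap ∘ₗ (leviCivita N x).toLinearMap
      - (innerSL ℝ (leviCivita N x w)).toLinearMap) (F x)
  have e2 := sum_inner_mul_map (stdOrthonormalBasis ℝ (TangentSpace I x))
    (((innerSL ℝ).flip w).toLinearMap ∘ₗ (leviCivita N x).toLinearMap) (X x)
  have e3 := sum_inner_mul_map (stdOrthonormalBasis ℝ (TangentSpace I x))
    (((innerSL ℝ).flip w).toLinearMap ∘ₗ (leviCivita X x).toLinearMap) (N x)
  simp only [LinearMap.sub_apply, LinearMap.comp_apply, ContinuousLinearMap.coe_coe,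
    ContinuousLinearMap.flip_apply, innerSL_apply_apply] at e1 e2 e3
  rw [curl, ← e1, ← e2, ← e3]
  simp only [← Finset.sum_add_distrib, ← Finset.sum_sub_distrib]
  refine Finset.sum_congr rfl fun i _ ↦ ?_
  rw [curl]
  ring

/-- Expands the completed squares `|∇A - α ⊗ B|²` and `|∇B + α ⊗ A|²`; the cross term contracts to
the derivative along `N`. -/
theorem sum_norm_sq_add_smul {V ι : Type*} [NormedAddCommGroup V] [InnerProductSpace ℝ V]
    [Fintype ι] (b : OrthonormalBasis ι ℝ V) (T : V →ₗ[ℝ] V) (n X : V) :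
    ∑ i, ‖T (b i) + inner ℝ n (b i) • X‖ ^ 2 =
      ∑ i, ‖T (b i)‖ ^ 2 + 2 * inner ℝ (T n) X + inner ℝ n n * inner ℝ X X := by
  have e1 := sum_inner_mul_map b ((innerₗ V X) ∘ₗ T) n
  have e2 := sum_inner_mul_map b (innerₗ V n) n
  simp only [LinearMap.comp_apply, innerₗ_apply_apply] at e1 e2
  rw [real_inner_comm, ← e1, ← e2, Finset.mul_sum, Finset.sum_mul, ← Finset.sum_add_distrib,
    ← Finset.sum_add_distrib]
  refine Finset.sum_congr rfl fun i _ ↦ ?_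
  rw [norm_add_sq_real, norm_smul, mul_pow, inner_smul_right, real_inner_comm X,
    real_inner_self_eq_norm_sq, Real.norm_eq_abs, sq_abs]
  ring

/-- The magnetic Bochner formula in terms of the real and imaginary part `A`, `B` of the magnetic
gradient of `u + ih`, with the potential given by the field `N`. -/
theorem magnetic_bochner_real {u h : M → ℝ} {A B N GA GB : Π x : M, TangentSpace I x} {x : M}
    (hu : SmoothFunNear I u x) (hh : SmoothFunNear I h x) (hA : SmoothNear A x)
    (hB : SmoothNear B x) (hN : SmoothNear N x)
    (eA : ∀ᶠ y in 𝓝 x, ∀ v, inner ℝ (A y) v = mvfderiv I u y v - h y * inner ℝ (N y) v)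
    (eB : ∀ᶠ y in 𝓝 x, ∀ v, inner ℝ (B y) v = mvfderiv I h y v + u y * inner ℝ (N y) v)
    (hGA : SmoothNear GA x) (hGB : SmoothNear GB x)
    (eGA : ∀ᶠ y in 𝓝 x, ∀ v, inner ℝ (GA y) v = inner ℝ (leviCivita A y v) (A y))
    (eGB : ∀ᶠ y in 𝓝 x, ∀ v, inner ℝ (GB y) v = inner ℝ (leviCivita B y v) (B y)) :
    realDivergence GA x + realDivergence GB x =
      (∑ i, ‖leviCivita A x (stdOrthonormalBasis ℝ (TangentSpace I x) i)
          - inner ℝ (N x) (stdOrthonormalBasis ℝ (TangentSpace I x) i) • B x‖ ^ 2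
        + ∑ i, ‖leviCivita B x (stdOrthonormalBasis ℝ (TangentSpace I x) i)
          + inner ℝ (N x) (stdOrthonormalBasis ℝ (TangentSpace I x) i) • A x‖ ^ 2)
      + (mvfderiv I (fun y ↦ realDivergence A y - inner ℝ (B y) (N y)) x (A x)
        + mvfderiv I (fun y ↦ realDivergence B y + inner ℝ (A y) (N y)) x (B x)
        - (realDivergence B x + inner ℝ (A x) (N x)) * inner ℝ (A x) (N x)
        + (realDivergence A x - inner ℝ (B x) (N x)) * inner ℝ (B x) (N x))
      + (ricci x (A x) (A x) + ricci x (B x) (B x))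
      + 4 * curl N x (A x) (B x)
      + (h x * codifferential (curl N) x (A x) - u x * codifferential (curl N) x (B x)) := by
  have hnh : SmoothFunNear I (fun y ↦ -h y) x := by
    simpa using (SmoothFunNear.const 0 x).sub hh
  have hnB : SmoothNear (fun y ↦ - B y) x := by
    simpa using (SmoothNear.zero x).sub hB
  have dnh : ∀ y v, mvfderiv I (fun y ↦ -h y) y v = - mvfderiv I h y v := fun y v ↦ by
    rw [mvfderiv_fun_neg]; rfl
  -- the gradients of `u` and `-h`
  have eFu : ∀ᶠ y in 𝓝 x, ∀ v, inner ℝ (A y + h y • N y) v = mvfderiv I u y v := by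
    filter_upwards [eA] with y hy v
    rw [inner_add_left, hy, inner_smul_left]
    simp
  have eFh : ∀ᶠ y in 𝓝 x, ∀ v, inner ℝ (u y • N y - B y) v = mvfderiv I (fun y ↦ -h y) y v := by
    filter_upwards [eB] with y hy v
    rw [inner_sub_left, hy, inner_smul_left, dnh]
    simp
  -- The gradient of `-h` is `uN - B`; its `N` part drops out of the wedge product with `N`.
  have curlA : ∀ᶠ y in 𝓝 x, ∀ v w, curl A y v w = (-h y) * curl N y v w
      + (inner ℝ (-B y) v * inner ℝ (N y) w - inner ℝ (-B y) w * inner ℝ (N y) v) := by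
    filter_upwards [hu.eventually, hnh.eventually, hA.eventually, hN.eventually,
      eventually_eventually_nhds.2 eA, eFh] with y h1 h2 h3 h4 h5 h6 v w
    rw [curl_of_gradient_sub_smul (F := fun y ↦ u y • N y - B y) h1 h2 h3 h4 (by
      filter_upwards [h5] with z hz v
      rw [hz]; ring) h6]
    simp only [inner_sub_left, inner_smul_left, inner_neg_left, conj_trivial]
    ring
  have curlB : ∀ᶠ y in 𝓝 x, ∀ v w, curl B y v w = u y * curl N y v w
      + (inner ℝ (A y) v * inner ℝ (N y) w - inner ℝ (A y) w * inner ℝ (N y) v) := by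
    filter_upwards [hh.eventually, hu.eventually, hB.eventually, hN.eventually,
      eventually_eventually_nhds.2 eB, eFu] with y h1 h2 h3 h4 h5 h6 v w
    rw [curl_of_gradient_sub_smul (F := fun y ↦ A y + h y • N y) h1 h2 h3 h4 h5 h6]
    simp only [inner_add_left, inner_smul_left, conj_trivial]
    ring
  have bA := realDivergence_gradient_normSq hA hGA eGA
  have bB := realDivergence_gradient_normSq hB hGB eGB
  rw [codifferential_congr curlA] at bA
  rw [codifferential_congr curlB] at bB
  have cA := codifferential_smul_curl_add_wedge (F := fun y ↦ u y • N y - B y) hnh hnB hN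
    eFh.self_of_nhds (A x)
  have cB := codifferential_smul_curl_add_wedge (F := fun y ↦ A y + h y • N y) hu hA hN
    eFu.self_of_nhds (B x)
  have negB : ∀ v, leviCivita (fun y ↦ -B y) x v = - leviCivita B x v := fun v ↦ by
    have := leviCivita_sub_apply (SmoothNear.zero x) hB v
    simpa [leviCivita_zero_apply] using this
  have divnB : realDivergence (fun y ↦ -B y) x = - realDivergence B x := by
    simp [realDivergence, negB]
  -- After expansion, the surplus derivatives of `A` and `B` on the right are exactly `curl A (B, N)
  -- + curl B (N, A)`. The formulas for the curls convert them into terms that cancel the rest,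
  -- including `|N|²(|A|² + |B|²)` from the squares.
  have kA := curlA.self_of_nhds (B x) (N x)
  have kB := curlB.self_of_nhds (N x) (A x)
  have sA := sum_norm_sq_add_smul (stdOrthonormalBasis ℝ (TangentSpace I x))
    (leviCivita A x).toLinearMap (N x) (-B x)
  have sB := sum_norm_sq_add_smul (stdOrthonormalBasis ℝ (TangentSpace I x))
    (leviCivita B x).toLinearMap (N x) (A x)
  simp only [ContinuousLinearMap.coe_coe, smul_neg, ← sub_eq_add_neg] at sA sB
  rw [sA, sB, bA, bB, mvfderiv_fun_sub hA.realDivergence.mdiff (hB.inner hN).mdiff,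
    mvfderiv_fun_add hB.realDivergence.mdiff (hA.inner hN).mdiff, sub_apply, add_apply,
    mvfderiv_inner hB hN, mvfderiv_inner hA hN]
  rw [divnB, negB] at cA
  simp only [curl, map_add, map_sub, map_neg, map_smul, inner_add_left, inner_sub_left,
    inner_neg_left, inner_smul_left, inner_add_right, inner_sub_right, inner_neg_right,
    inner_smul_right, conj_trivial] at cA cB kA kB ⊢
  simp only [real_inner_comm (N x), real_inner_comm (A x) (B x)] at *
  linear_combination cA + cB - kA - kB
    + real_inner_comm (leviCivita N x (A x)) (B x) - real_inner_comm (leviCivita N x (B x)) (A x)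

end Magnetic

/-! ### Real and imaginary parts of the complex operators. -/

section Complexified

variable {E : Type*} [NormedAddCommGroup E] [NormedSpace ℝ E] [FiniteDimensional ℝ E]
  {H : Type*} [TopologicalSpace H] {I : ModelWithCorners ℝ E H}
  {M : Type*} [TopologicalSpace M] [ChartedSpace H M] [IsManifold I ∞ M]

theorem mvfderiv_complex {p q : M → ℝ} {x : M} (hp : SmoothFunNear I p x)
    (hq : SmoothFunNear I q x) (v : TangentSpace I x) :
    mvfderiv I (fun y ↦ (⟨p y, q y⟩ : ℂ)) x v = ⟨mvfderiv I p x v, mvfderiv I q x v⟩ := by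
  have e : (fun y ↦ (⟨p y, q y⟩ : ℂ)) = p • (fun _ ↦ (1 : ℂ)) + q • (fun _ ↦ Complex.I) := by
    funext y
    apply Complex.ext <;> simp
  have c1 : MDifferentiableAt I 𝓘(ℝ, ℂ) (fun _ : M ↦ (1 : ℂ)) x := mdifferentiableAt_const
  have c2 : MDifferentiableAt I 𝓘(ℝ, ℂ) (fun _ : M ↦ Complex.I) x := mdifferentiableAt_const
  rw [e, mvfderiv_add (hp.mdiff.smul c1) (hq.mdiff.smul c2), mvfderiv_smul hp.mdiff c1,
    mvfderiv_smul hq.mdiff c2, mvfderiv_const, mvfderiv_const]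
  apply Complex.ext <;> simp

variable [Bundle.RiemannianBundle (fun x : M ↦ TangentSpace I x)]

theorem inner_sharp_re {x : M} (w : TangentSpace I x →ₗ[ℝ] ℂ) (v : TangentSpace I x) :
    inner ℝ (sharp (fun z ↦ w z)).re v = (w v).re := by
  have h := sum_inner_mul_map (stdOrthonormalBasis ℝ (TangentSpace I x))
    (Complex.reLm ∘ₗ w) v
  simp only [LinearMap.comp_apply, Complex.reLm_coe] at h
  rw [← h]
  simp [sharp, sum_inner, inner_smul_left, real_inner_comm, mul_comm]

theorem inner_sharp_im {x : M} (w : TangentSpace I x →ₗ[ℝ] ℂ) (v : TangentSpace I x) :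
    inner ℝ (sharp (fun z ↦ w z)).im v = (w v).im := by
  have h := sum_inner_mul_map (stdOrthonormalBasis ℝ (TangentSpace I x))
    (Complex.imLm ∘ₗ w) v
  simp only [LinearMap.comp_apply, Complex.imLm_coe] at h
  rw [← h]
  simp [sharp, sum_inner, inner_smul_left, real_inner_comm, mul_comm]

theorem inner_sharp_ofReal_re {x : M} (w : TangentSpace I x →ₗ[ℝ] ℝ) (v : TangentSpace I x) :
    inner ℝ (sharp (fun z ↦ (w z : ℂ))).re v = w v :=
  inner_sharp_re (Complex.ofRealCLM.toLinearMap ∘ₗ w) v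

theorem sharp_ofReal_im {x : M} (w : TangentSpace I x → ℝ) :
    (sharp (fun z ↦ (w z : ℂ))).im = 0 := by
  simp [sharp]

/-- The magnetic differential as a linear map. -/
def magneticDifferentialₗ (α : Π x : M, TangentSpace I x →L[ℝ] ℝ) (f : M → ℂ) (x : M) :
    TangentSpace I x →ₗ[ℝ] ℂ where
  toFun := magneticDifferential α f x
  map_add' v w := by simp [magneticDifferential]; ring
  map_smul' c v := by simp [magneticDifferential]; ring

theorem inner_magneticGradient_re {α : Π x : M, TangentSpace I x →L[ℝ] ℝ} {p q : M → ℝ} {x : M}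
    (hp : SmoothFunNear I p x) (hq : SmoothFunNear I q x) (v : TangentSpace I x) :
    inner ℝ (magneticGradient α (fun y ↦ ⟨p y, q y⟩) x).re v = mvfderiv I p x v - q x * α x v := by
  have h := inner_sharp_re (magneticDifferentialₗ α (fun y ↦ ⟨p y, q y⟩) x) v
  refine h.trans ?_
  simp [magneticDifferentialₗ, magneticDifferential, mvfderiv_complex hp hq]
  ring

theorem inner_magneticGradient_im {α : Π x : M, TangentSpace I x →L[ℝ] ℝ} {p q : M → ℝ} {x : M}
    (hp : SmoothFunNear I p x) (hq : SmoothFunNear I q x) (v : TangentSpace I x) :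
    inner ℝ (magneticGradient α (fun y ↦ ⟨p y, q y⟩) x).im v = mvfderiv I q x v + p x * α x v := by
  have h := inner_sharp_im (magneticDifferentialₗ α (fun y ↦ ⟨p y, q y⟩) x) v
  refine h.trans ?_
  simp [magneticDifferentialₗ, magneticDifferential, mvfderiv_complex hp hq]

variable [IsContMDiffRiemannianBundle I ∞ E (fun x : M ↦ TangentSpace I x)]

theorem divergence_eq (X : Π x : M, Complexification (TangentSpace I x)) (x : M) :
    divergence X x = ⟨realDivergence (fun y ↦ (X y).re) x, realDivergence (fun y ↦ (X y).im) x⟩ := by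
  apply Complex.ext <;> simp [divergence, realDivergence, hinner, sesq, covDeriv, ofReal]

theorem realDivergence_congr {X Y : Π x : M, TangentSpace I x} {x : M} (hX : SmoothNear X x)
    (h : ∀ᶠ y in 𝓝 x, Y y = X y) : realDivergence Y x = realDivergence X x := by
  simp only [realDivergence, leviCivita_congr hX h]

theorem realDivergence_add {X Y : Π x : M, TangentSpace I x} {x : M} (hX : SmoothNear X x)
    (hY : SmoothNear Y x) :
    realDivergence (fun y ↦ X y + Y y) x = realDivergence X x + realDivergence Y x := by
  simp only [realDivergence, leviCivita_add_apply hX hY, inner_add_left, Finset.sum_add_distrib]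

theorem realDivergence_zero (x : M) :
    realDivergence (fun y ↦ (0 : TangentSpace I y)) x = 0 := by
  simp [realDivergence, leviCivita_zero_apply]

/-- The field dual to the codifferential of `curl N`. -/
theorem exists_codifferential_eq_inner {N : Π x : M, TangentSpace I x} {x : M}
    (hN : SmoothNear N x) :
    ∃ D : TangentSpace I x, ∀ w, codifferential (curl N) x w = inner ℝ D w := by
  let b := stdOrthonormalBasis ℝ (TangentSpace I x)
  -- Linearity of the codifferential in `w` is read off the Weitzenböck formula, whose other terms
  -- are linear. For the Ricci term, symmetry and antisymmetry of the curvature bring `w` into the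
  -- inner product.
  refine ⟨(InnerProductSpace.toDual ℝ (TangentSpace I x)).symm (mvfderiv I (realDivergence N) x)
    - ∑ i, curvature x (b i) (N x) (b i)
    - ∑ i, secondCovDeriv N (FiberBundle.extend E (b i)) x (b i), fun w ↦ ?_⟩
  have h := sum_inner_secondCovDeriv hN w
  have hr : ricci x w (N x) = - inner ℝ (∑ i, curvature x (b i) (N x) (b i)) w := by
    rw [ricci_comm, ricci, sum_inner, ← Finset.sum_neg_distrib]
    refine Finset.sum_congr rfl fun i _ ↦ ?_
    have := inner_fieldCurvature_antisymm (SmoothNear.extend (b i)) (SmoothNear.extend (N x))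
      (SmoothNear.extend w) (SmoothNear.extend (b i))
    simp only [FiberBundle.extend_apply_self] at this
    rw [curvature_eq_fieldCurvature, curvature_eq_fieldCurvature, this, real_inner_comm]
  rw [inner_sub_left, inner_sub_left, InnerProductSpace.toDual_symm_apply, sum_inner (f := fun i ↦
    secondCovDeriv N (FiberBundle.extend E (b i)) x (b i)), h, hr]
  ring

theorem inner_sharp_codifferential {N : Π x : M, TangentSpace I x} {x : M}
    (hN : SmoothNear N x) (v : TangentSpace I x) :
    inner ℝ v (sharp (fun w ↦ (codifferential (curl N) x w : ℂ))).re =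
      codifferential (curl N) x v := by
  obtain ⟨D, hD⟩ := exists_codifferential_eq_inner hN
  simp only [hD]
  rw [real_inner_comm]
  exact inner_sharp_ofReal_re (innerₗ _ D) v

/-- `GA` and `GB` are gradients of half the squared norms, hence the factor 2; the sign comes from
`Δ = -div grad`. -/
theorem laplaceBeltrami_normSq {X : Π x : M, Complexification (TangentSpace I x)}
    {GA GB : Π x : M, TangentSpace I x} {x : M}
    (hA : SmoothNear (fun y ↦ (X y).re) x) (hB : SmoothNear (fun y ↦ (X y).im) x)
    (hGA : SmoothNear GA x) (hGB : SmoothNear GB x)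
    (eGA : ∀ᶠ y in 𝓝 x, ∀ v, inner ℝ (GA y) v =
      inner ℝ (leviCivita (fun y ↦ (X y).re) y v) (X y).re)
    (eGB : ∀ᶠ y in 𝓝 x, ∀ v, inner ℝ (GB y) v =
      inner ℝ (leviCivita (fun y ↦ (X y).im) y v) (X y).im) :
    laplaceBeltrami I (fun y ↦ (normSq (X y) : ℂ)) x =
      ((-2 * (realDivergence GA x + realDivergence GB x) : ℝ) : ℂ) := by
  have hs : ∀ y, SmoothFunNear I (fun _ : M ↦ (0 : ℝ)) y := fun y ↦ SmoothFunNear.const 0 y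
  have hn : ∀ y, normSq (X y) = inner ℝ (X y).re (X y).re + inner ℝ (X y).im (X y).im := fun y ↦ by
    simp [normSq]
  have hsm := (hA.inner hA).add (hB.inner hB)
  have hd : ∀ᶠ y in 𝓝 x, ∀ v, mvfderiv I (fun y ↦ (normSq (X y) : ℂ)) y v =
      ((inner ℝ (GA y + GB y + (GA y + GB y)) v : ℝ) : ℂ) := by
    filter_upwards [hA.eventually, hB.eventually, eGA, eGB, hsm.eventually] with y h1 h2 h3 h4 h5 v
    have e : (fun y ↦ (normSq (X y) : ℂ)) =
        fun y ↦ (⟨inner ℝ (X y).re (X y).re + inner ℝ (X y).im (X y).im, 0⟩ : ℂ) := by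
      funext y
      rw [hn]
      rfl
    rw [e, mvfderiv_complex h5 (hs y), mvfderiv_const,
      mvfderiv_fun_add (h1.inner h1).mdiff (h2.inner h2).mdiff, add_apply, mvfderiv_inner h1 h1,
      mvfderiv_inner h2 h2]
    simp only [inner_add_left, h3, h4]
    rw [real_inner_comm (leviCivita _ y v), real_inner_comm (leviCivita _ y v)]
    apply Complex.ext
    · simp only [Complex.ofReal_re]
      ring
    · simp
  have hre : ∀ᶠ y in 𝓝 x, (gradient I (fun y ↦ (normSq (X y) : ℂ)) y).re =
      GA y + GB y + (GA y + GB y) := by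
    filter_upwards [hd] with y hy
    refine ext_inner_right ℝ fun v ↦ ?_
    refine (inner_sharp_re (mvfderiv I (fun y ↦ (normSq (X y) : ℂ)) y).toLinearMap v).trans ?_
    simp [hy]
  have him : ∀ᶠ y in 𝓝 x, (gradient I (fun y ↦ (normSq (X y) : ℂ)) y).im = 0 := by
    filter_upwards [hd] with y hy
    refine ext_inner_right ℝ fun v ↦ ?_
    refine (inner_sharp_im (mvfderiv I (fun y ↦ (normSq (X y) : ℂ)) y).toLinearMap v).trans ?_
    simp [hy]
  have hG := hGA.add hGB
  rw [laplaceBeltrami, divergence_eq, realDivergence_congr (hG.add hG) hre,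
    realDivergence_congr (SmoothNear.zero x) him, realDivergence_add hG hG,
    realDivergence_add hGA hGB, realDivergence_zero]
  apply Complex.ext
  · simp only [Complex.neg_re, Complex.ofReal_re]
    ring
  · simp

/-- Against a real basis, squared moduli split into real and imaginary parts, and Parseval sums
them. Multiplication by `iα` exchanges the two parts of the gradient, with a sign. -/
theorem magneticHessianNormSq_eq {α : Π x : M, TangentSpace I x →L[ℝ] ℝ} (f : M → ℂ) (x : M) :
    magneticHessianNormSq α f x =
      ∑ i, ‖leviCivita (fun y ↦ (magneticGradient α f y).re) x
            (stdOrthonormalBasis ℝ (TangentSpace I x) i)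
          - α x (stdOrthonormalBasis ℝ (TangentSpace I x) i) • (magneticGradient α f x).im‖ ^ 2
        + ∑ i, ‖leviCivita (fun y ↦ (magneticGradient α f y).im) x
            (stdOrthonormalBasis ℝ (TangentSpace I x) i)
          + α x (stdOrthonormalBasis ℝ (TangentSpace I x) i) • (magneticGradient α f x).re‖ ^ 2 := by
  rw [magneticHessianNormSq, ← Finset.sum_add_distrib]
  refine Finset.sum_congr rfl fun i _ ↦ ?_
  rw [← (stdOrthonormalBasis ℝ (TangentSpace I x)).sum_sq_norm_inner_left (leviCivita _ x _ - _),
    ← (stdOrthonormalBasis ℝ (TangentSpace I x)).sum_sq_norm_inner_left (leviCivita _ x _ + _),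
    ← Finset.sum_add_distrib]
  refine Finset.sum_congr rfl fun j _ ↦ ?_
  rw [← Complex.normSq_eq_norm_sq, Complex.normSq_apply, Real.norm_eq_abs, Real.norm_eq_abs, sq_abs,
    sq_abs]
  have h1 : (magneticCovDeriv α (magneticGradient α f) x
      (stdOrthonormalBasis ℝ (TangentSpace I x) i)).re = leviCivita (fun y ↦ (magneticGradient α f y).re) x
            (stdOrthonormalBasis ℝ (TangentSpace I x) i)
          - α x (stdOrthonormalBasis ℝ (TangentSpace I x) i) • (magneticGradient α f x).im := by
    change _ + (_ • _ - _ • _) = _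
    simp [covDeriv, sub_eq_add_neg]
  have h2 : (magneticCovDeriv α (magneticGradient α f) x
      (stdOrthonormalBasis ℝ (TangentSpace I x) i)).im = leviCivita (fun y ↦ (magneticGradient α f y).im) x
            (stdOrthonormalBasis ℝ (TangentSpace I x) i)
          + α x (stdOrthonormalBasis ℝ (TangentSpace I x) i) • (magneticGradient α f x).re := by
    change _ + (_ • _ + _ • _) = _
    simp [covDeriv]
  simp only [magneticHessian, hinner, sesq, ofReal, h1, h2, inner_zero_right, add_zero, sub_zero]
  ring

theorem magneticLaplacian_eq {α : Π x : M, TangentSpace I x →L[ℝ] ℝ} (f : M → ℂ) (x : M) :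
    magneticLaplacian α f x =
      ⟨-(realDivergence (fun y ↦ (magneticGradient α f y).re) x
          - inner ℝ (magneticGradient α f x).im (potentialField α x).re),
        -(realDivergence (fun y ↦ (magneticGradient α f y).im) x
          + inner ℝ (magneticGradient α f x).re (potentialField α x).re)⟩ := by
  have h : (potentialField α x).im = 0 := sharp_ofReal_im (α x)
  have h' : magneticLaplacian α f x = -magneticDivergence α (magneticGradient α f) x := rfl
  rw [h', magneticDivergence, divergence_eq, hinner, sesq, h]
  apply Complex.ext
  · simp
    ring
  · simp

end Complexified

/-! ### Smoothness of the potential. -/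

section Potential

variable {E : Type*} [NormedAddCommGroup E] [NormedSpace ℝ E] [FiniteDimensional ℝ E]
  {H : Type*} [TopologicalSpace H] {I : ModelWithCorners ℝ E H}
  {M : Type*} [TopologicalSpace M] [ChartedSpace H M] [IsManifold I ∞ M]

theorem SmoothFunNear.of_clm {α : Π x : M, TangentSpace I x →L[ℝ] ℝ}
    (hα : ContMDiff I (I.prod 𝓘(ℝ, E →L[ℝ] ℝ)) ∞
      (fun x ↦ Bundle.TotalSpace.mk' (E →L[ℝ] ℝ) x (α x)))
    {Z : Π x : M, TangentSpace I x} {x : M} (hZ : SmoothNear Z x) :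
    SmoothFunNear I (fun y ↦ α y (Z y)) x := by
  filter_upwards [hZ] with y hy
  have h : ContMDiffAt I (I.prod 𝓘(ℝ, ℝ)) ∞
      (fun m ↦ Bundle.TotalSpace.mk' ℝ (E := Bundle.Trivial M ℝ) m (α m (Z m))) y :=
    ContMDiffAt.clm_bundle_apply (F₁ := E) (F₂ := ℝ) (b := fun m ↦ m) (hα y) hy
  rw [Bundle.contMDiffAt_totalSpace] at h
  simpa using! h.2

end Potential

end MagneticBochner

end

/-! ### Assembly of the complex formula. -/

open MagneticBochner Complexification in
theorem theorem4p1
    {E : Type*} [NormedAddCommGroup E] [NormedSpace ℝ E] [FiniteDimensional ℝ E]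
    {H : Type*} [TopologicalSpace H] {I : ModelWithCorners ℝ E H} [I.Boundaryless]
    {M : Type*} [TopologicalSpace M] [ChartedSpace H M] [IsManifold I ∞ M]
    [Bundle.RiemannianBundle (fun x : M ↦ TangentSpace I x)]
    [IsContMDiffRiemannianBundle I ∞ E (fun x : M ↦ TangentSpace I x)]
    (α : Π x : M, TangentSpace I x →L[ℝ] ℝ)
    (hα : ContMDiff I (I.prod 𝓘(ℝ, E →L[ℝ] ℝ)) ∞
      (fun x ↦ Bundle.TotalSpace.mk' (E →L[ℝ] ℝ) x (α x)))
    (f : M → ℂ) (hf : ContMDiff I 𝓘(ℝ, ℂ) ∞ f) (x : M) :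
    -(1 / 2) * laplaceBeltrami I (fun y ↦ (normSq (magneticGradient α f y) : ℂ)) x =
      (magneticHessianNormSq α f x : ℂ)
        - (1 / 2) *
          (hinner (magneticGradient α f x) (magneticGradient α (magneticLaplacian α f) x)
            + hinner (magneticGradient α (magneticLaplacian α f) x) (magneticGradient α f x))
        + sesq (ricci x) (magneticGradient α f x) (magneticGradient α f x)
        + Complex.I *
          (bilin (extDeriv α x) (magneticGradient α f x) (conj (magneticGradient α f x))
            - bilin (extDeriv α x) (conj (magneticGradient α f x)) (magneticGradient α f x))
        + (Complex.I / 2) *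
          (hinner ((starRingEnd ℂ (f x)) • magneticGradient α f x)
              (sharp (fun v ↦ (codifferential (extDeriv α) x v : ℂ)))
            - hinner (f x • conj (magneticGradient α f x))
              (sharp (fun v ↦ (codifferential (extDeriv α) x v : ℂ)))) := by
  let u : M → ℝ := fun y ↦ (f y).re
  let h : M → ℝ := fun y ↦ (f y).im
  let A : Π y : M, TangentSpace I y := fun y ↦ (magneticGradient α f y).re
  let B : Π y : M, TangentSpace I y := fun y ↦ (magneticGradient α f y).im
  let N : Π y : M, TangentSpace I y := fun y ↦ (potentialField α y).re
  have hu : ∀ y, SmoothFunNear I u y := fun y ↦ Filter.Eventually.of_forall fun z ↦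
    Complex.reCLM.contMDiff.contMDiffAt.comp z (hf z)
  have hh : ∀ y, SmoothFunNear I h y := fun y ↦ Filter.Eventually.of_forall fun z ↦
    Complex.imCLM.contMDiff.contMDiffAt.comp z (hf z)
  have eN : ∀ y v, α y v = inner ℝ (N y) v := fun y v ↦
    (inner_sharp_ofReal_re (α y).toLinearMap v).symm
  have hN : ∀ y, SmoothNear N y := fun y ↦ SmoothNear.of_inner fun Z hZ ↦
    (SmoothFunNear.of_clm hα hZ).congr (Filter.Eventually.of_forall fun z ↦ (eN z (Z z)).symm)
  have eA : ∀ y v, inner ℝ (A y) v = mvfderiv I u y v - h y * inner ℝ (N y) v := fun y v ↦ by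
    rw [← eN]
    exact inner_magneticGradient_re (hu y) (hh y) v
  have eB : ∀ y v, inner ℝ (B y) v = mvfderiv I h y v + u y * inner ℝ (N y) v := fun y v ↦ by
    rw [← eN]
    exact inner_magneticGradient_im (hu y) (hh y) v
  have hA : ∀ y, SmoothNear A y := fun y ↦ SmoothNear.of_inner fun Z hZ ↦
    (((hu y).mvfderiv hZ).sub ((hh y).mul ((hN y).inner hZ))).congr
      (Filter.Eventually.of_forall fun z ↦ eA z (Z z))
  have hB : ∀ y, SmoothNear B y := fun y ↦ SmoothNear.of_inner fun Z hZ ↦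
    (((hh y).mvfderiv hZ).add ((hu y).mul ((hN y).inner hZ))).congr
      (Filter.Eventually.of_forall fun z ↦ eB z (Z z))
  -- the gradients of half the squared norms
  have grad : ∀ X : Π y : M, TangentSpace I y, (∀ y, SmoothNear X y) →
      ∃ G : Π y : M, TangentSpace I y, SmoothNear G x ∧
        ∀ y v, inner ℝ (G y) v = inner ℝ (leviCivita X y v) (X y) := fun X hX ↦ by
    have e : ∀ y v, inner ℝ (sharp (fun w ↦ ((inner ℝ (leviCivita X y w) (X y) : ℝ) : ℂ))).re v =
        inner ℝ (leviCivita X y v) (X y) := fun y v ↦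
      inner_sharp_ofReal_re ((innerₗ _).flip (X y) ∘ₗ (leviCivita X y).toLinearMap) v
    exact ⟨_, SmoothNear.of_inner fun Z hZ ↦ (((hX x).leviCivita hZ).inner (hX x)).congr
      (Filter.Eventually.of_forall fun z ↦ e z (Z z)), e⟩
  obtain ⟨GA, hGA, eGA⟩ := grad A hA
  obtain ⟨GB, hGB, eGB⟩ := grad B hB
  have key := magnetic_bochner_real (hu x) (hh x) (hA x) (hB x) (hN x) (.of_forall eA)
    (.of_forall eB) hGA hGB (.of_forall eGA) (.of_forall eGB)
  have lap := laplaceBeltrami_normSq (X := magneticGradient α f) (hA x) (hB x) hGA hGB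
    (.of_forall eGA) (.of_forall eGB)
  have hess := magneticHessianNormSq_eq (α := α) f x
  simp only [eN] at hess
  rw [← hess] at key
  -- the magnetic gradient of the magnetic Laplacian
  have dP := (hA x).realDivergence.sub ((hB x).inner (hN x))
  have dQ := (hB x).realDivergence.add ((hA x).inner (hN x))
  have neg : ∀ {p : M → ℝ}, SmoothFunNear I p x → SmoothFunNear I (fun y ↦ -p y) x :=
    fun hp ↦ by simpa using (SmoothFunNear.const 0 x).sub hp
  have eL : magneticLaplacian α f = fun y ↦
      (⟨-(realDivergence A y - inner ℝ (B y) (N y)),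
        -(realDivergence B y + inner ℝ (A y) (N y))⟩ : ℂ) :=
    funext fun y ↦ magneticLaplacian_eq f y
  have eLre := fun v ↦ inner_magneticGradient_re (α := α) (neg dP) (neg dQ) v
  have eLim := fun v ↦ inner_magneticGradient_im (α := α) (neg dP) (neg dQ) v
  rw [← eL] at eLre eLim
  have hcurl : extDeriv α = curl N := by
    funext y v w
    exact extDeriv_eq_curl (hN y) eN v w
  have hδ := inner_sharp_codifferential (hN x)
  have hδ' := sharp_ofReal_im (codifferential (curl N) x)
  -- Symmetry of the Ricci tensor makes the imaginary part of its sesquilinear extension vanish on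
  -- the diagonal.
  have hric := ricci_comm x (A x) (B x)
  rw [lap, hcurl]
  simp only [mvfderiv_fun_neg, neg_apply, eN] at eLre eLim
  have t1 : hinner (magneticGradient α f x) (magneticGradient α (magneticLaplacian α f) x)
      + hinner (magneticGradient α (magneticLaplacian α f) x) (magneticGradient α f x) =
      ((2 * (inner ℝ (magneticGradient α (magneticLaplacian α f) x).re (A x)
        + inner ℝ (magneticGradient α (magneticLaplacian α f) x).im (B x)) : ℝ) : ℂ) := by
    apply Complex.ext
    · simp only [hinner, sesq, Complex.add_re, Complex.ofReal_re]
      rw [real_inner_comm (magneticGradient α (magneticLaplacian α f) x).re,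
        real_inner_comm (magneticGradient α (magneticLaplacian α f) x).im]
      ring
    · simp only [hinner, sesq, Complex.add_im, Complex.ofReal_im]
      rw [real_inner_comm (magneticGradient α (magneticLaplacian α f) x).re,
        real_inner_comm (magneticGradient α (magneticLaplacian α f) x).im]
      ring
  have t2 : sesq (ricci x) (magneticGradient α f x) (magneticGradient α f x) =
      ((ricci x (A x) (A x) + ricci x (B x) (B x) : ℝ) : ℂ) :=
    Complex.ext rfl (sub_eq_zero.2 hric.symm)
  -- With `X = A + iB`, `dα(X, conj X) = -2i dα(A, B)`; skew-symmetry doubles it, and the factor `i`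
  -- gives `4 dα(A, B)`.
  have t3 : Complex.I *
      (bilin (curl N x) (magneticGradient α f x) (conj (magneticGradient α f x))
        - bilin (curl N x) (conj (magneticGradient α f x)) (magneticGradient α f x)) =
      ((4 * curl N x (A x) (B x) : ℝ) : ℂ) := by
    apply Complex.ext
    · simp [bilin, conj, curl, A, B]
      ring
    · simp [bilin, conj, curl]
  -- The fields `conj f • X` and `f • conj X` are conjugate, so their difference is `2i(uB - hA)`;
  -- it is paired with a real vector.
  have t4 : (Complex.I / 2) *
      (hinner ((starRingEnd ℂ (f x)) • magneticGradient α f x)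
          (sharp (fun v ↦ (codifferential (curl N) x v : ℂ)))
        - hinner (f x • conj (magneticGradient α f x))
          (sharp (fun v ↦ (codifferential (curl N) x v : ℂ)))) =
      ((h x * codifferential (curl N) x (A x) - u x * codifferential (curl N) x (B x) : ℝ) : ℂ) := by
    have re_smul : ∀ (c : ℂ) (Y : Complexification (TangentSpace I x)),
        (c • Y).re = c.re • Y.re - c.im • Y.im := fun _ _ ↦ rfl
    have im_smul : ∀ (c : ℂ) (Y : Complexification (TangentSpace I x)),
        (c • Y).im = c.re • Y.im + c.im • Y.re := fun _ _ ↦ rfl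
    have hI : ∀ z : ℂ, Complex.I / 2 * z = ⟨-z.im / 2, z.re / 2⟩ := fun z ↦ by
      apply Complex.ext <;> simp <;> ring
    rw [hI]
    obtain ⟨D, hD⟩ := exists_codifferential_eq_inner (hN x)
    apply Complex.ext
    · simp [hinner, sesq, conj, re_smul, im_smul, hδ', hδ]
      simp only [hD, inner_add_right, inner_neg_right, inner_smul_right, u, h, A, B]
      ring
    · simp [hinner, sesq, conj, re_smul, im_smul, hδ', hδ]
  rw [t1, t2, t3, t4, eLre, eLim]
  rw [real_inner_comm (A x) (N x), real_inner_comm (B x) (N x)]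
  have key' := congrArg (fun r : ℝ ↦ (r : ℂ)) key
  push_cast at key' ⊢
  linear_combination key'
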